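/- Let $n\ge 1$, $s\in(0,1)$ and $\varepsilon>0$, with $2s+\varepsilon\le 1$ if $s<1/2$ and $2s+\varepsilon\le 2$ if $s\ge 1/2$. Definitions. For $u:\mathbb R^n\to\mathbb R$ set $$(-\Delta)^s u(x)=C(n,s)\lim_{\delta\to0^+}\int_{\mathbb R^n\setminus B_\delta(x)}\frac{u(x)-u(y)}{|x-y|^{n+2s}}\,dy,\qquad C(n,s)=\Big(\int_{\mathbb R^n}\frac{1-\cos\eta_1}{|\eta|^{n+2s}}\,d\eta\Big)^{-1},$$ whenever the integrals converge absolutely and the limit exists. Let $L^1_s(\mathbb R^n)$ be the set of $u\in L^1_{\rm loc}(\mathbb R^n)$ with $\int_{\mathbb R^n}\frac{|u(x)|}{1+|x|^{n+2s}}\,dx<\infty$, and let $\mathcal S_s(\mathbb R^n)$ be the set of $\psi\in C^\infty(\mathbb R^n)$ with $\sup_x(1+|x|^{n+2s})|D^\alpha\psi(x)|<\infty$ for every multi-index $\alpha$. A function $u\in L^1_s(\mathbb R^n)$ solves $(-\Delta)^su=f$ in the distributional sense if, for every Schwartz function $\varphi$, $(-\Delta)^s\varphi\in\mathcal S_s(\mathbb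 R^n)$ and $\int_{\mathbb R^n}u\,(-\Delta)^s\varphi\,dx=\int_{\mathbb R^n}f\varphi\,dx$, both integrals being absolutely convergent. For $s<1/2$, $C^{2s+\varepsilon}(\mathbb R^n)$ is the set of functions $u$ with $|u(x)-u(y)|\le C|x-y|^{2s+\varepsilon}$ for some $C$ and all $x,y\in\mathbb R^n$; for $s\ge1/2$ it is the set of $u\in C^1(\mathbb R^n)$ whose gradient is bounded and satisfies $|\nabla u(x)-\nabla u(y)|\le C|x-y|^{2s+\varepsilon-1}$ for some $C$ and all $x,y\in\mathbb R^n$. (The functions themselves are not required to be bounded.) $C^{2s+\varepsilon}_c(\mathbb R^n)$ is the set of its compactly supported elements. For $x\neq0$ let $$\Phi(x)=\frac{\Gamma(\frac n2-s)}{2^{2s}\pi^{n/2}\Gamma(s)}\,|x|^{2s-n}\ \text{ if } n\ne 2s,\qquad \Phi(x)=-\frac1\pi\log|x|\ \text{ if } n=2s.$$ Theorem. Let $f\in C^{2s+\varepsilon}_c(\mathbb R^n)$ be real-valued and $u=\Phi*f$ (the convolution integral converges absolutely at every point). Then $u\in L^1_s(\mathbb R^n)$ and $(-\Delta)^su=f$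 in the distributional sense. Moreover $u\in C^{2s+\varepsilon}(\mathbb R^n)$, $u$ is bounded if $n>2s$, and $(-\Delta)^su(x)=f(x)$ pointwise, for every $x\in\mathbb R^n$. -/

import Mathlib

open MeasureTheory Filter Topology
open scoped ContDiff SchwartzMap

namespace FracLap

noncomputable section

/-- The normalization constant `C(n,s) = (∫ (1 - cos η₁) / |η|^(n+2s) dη)⁻¹`. -/
def normConst (n : ℕ) [NeZero n] (s : ℝ) : ℝ :=
  (∫ η : EuclideanSpace ℝ (Fin n), (1 - Real.cos (η 0)) / ‖η‖ ^ ((n : ℝ) + 2 * s))⁻¹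

/-- The truncated singular integral
`C(n,s) ∫_{|x-y| ≥ δ} (u(x) - u(y)) / |x-y|^(n+2s) dy`. -/
def truncFracLaplacian {n : ℕ} [NeZero n] (s δ : ℝ) (u : EuclideanSpace ℝ (Fin n) → ℝ)
    (x : EuclideanSpace ℝ (Fin n)) : ℝ :=
  normConst n s *
    ∫ y in (Metric.ball x δ)ᶜ, (u x - u y) / ‖x - y‖ ^ ((n : ℝ) + 2 * s)

/-- `(-Δ)^s u (x)` exists as a principal value and equals `v`: the truncated integrals converge
absolutely, and they tend to `v` as the radius of the removed ball decreases to zero. -/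
def HasFracLaplacianAt {n : ℕ} [NeZero n] (s : ℝ) (u : EuclideanSpace ℝ (Fin n) → ℝ)
    (x : EuclideanSpace ℝ (Fin n)) (v : ℝ) : Prop :=
  (∀ δ : ℝ, 0 < δ →
    IntegrableOn (fun y : EuclideanSpace ℝ (Fin n) =>
      (u x - u y) / ‖x - y‖ ^ ((n : ℝ) + 2 * s)) (Metric.ball x δ)ᶜ) ∧
  Tendsto (fun δ : ℝ => truncFracLaplacian s δ u x) (𝓝[>] 0) (𝓝 v)

/-- The weighted space `L¹_s(ℝⁿ)`. -/
def MemL1s {n : ℕ} (s : ℝ) (u : EuclideanSpace ℝ (Fin n) → ℝ) : Prop :=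
  LocallyIntegrable u ∧
  Integrable (fun x : EuclideanSpace ℝ (Fin n) => |u x| / (1 + ‖x‖ ^ ((n : ℝ) + 2 * s)))

/-- The space `𝒮_s(ℝⁿ)` of smooth functions all of whose derivatives are `O((1+|x|^(n+2s))⁻¹)`. -/
def MemSs {n : ℕ} (s : ℝ) (ψ : EuclideanSpace ℝ (Fin n) → ℝ) : Prop :=
  ContDiff ℝ ∞ ψ ∧
  ∀ k : ℕ, ∃ C : ℝ, ∀ x : EuclideanSpace ℝ (Fin n),
    (1 + ‖x‖ ^ ((n : ℝ) + 2 * s)) * ‖iteratedFDeriv ℝ k ψ x‖ ≤ C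

/-- A function `u` in `L¹_s(ℝⁿ)`, seen as an element of the dual of `𝒮_s(ℝⁿ)` through
`ψ ↦ ∫ u ψ`, is a distributional solution of `(-Δ)^s u = f` in `ℝⁿ`: for every Schwartz function
`φ`, the function `ψ = (-Δ)^s φ` is an element of `𝒮_s(ℝⁿ)` and `∫ u ψ = ∫ f φ`. -/
def IsDistribSolution {n : ℕ} [NeZero n] (s : ℝ) (u f : EuclideanSpace ℝ (Fin n) → ℝ) : Prop :=
  ∀ φ : 𝓢(EuclideanSpace ℝ (Fin n), ℝ), ∃ ψ : EuclideanSpace ℝ (Fin n) → ℝ,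
    (∀ x, HasFracLaplacianAt s φ x (ψ x)) ∧ MemSs s ψ ∧
    Integrable (fun x => u x * ψ x) ∧ Integrable (fun x => f x * φ x) ∧
    ∫ x, u x * ψ x = ∫ x, f x * φ x

/-- The class `C^(2s+ε)(ℝⁿ)`. For `s < 1/2`: the (globally) Hölder continuous functions with
exponent `2s+ε`. For `s ≥ 1/2`: the continuously differentiable functions with bounded and
(globally) Hölder continuous gradient with exponent `2s+ε-1`. The functions themselves need not be
bounded. -/
def MemHolder {n : ℕ} (s ε : ℝ) (u : EuclideanSpace ℝ (Fin n) → ℝ) : Prop :=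
  (s < 1 / 2 → ∃ C : ℝ, ∀ x y, |u x - u y| ≤ C * ‖x - y‖ ^ (2 * s + ε)) ∧
  (1 / 2 ≤ s → ContDiff ℝ 1 u ∧ (∃ M : ℝ, ∀ x, ‖fderiv ℝ u x‖ ≤ M) ∧
    ∃ C : ℝ, ∀ x y, ‖fderiv ℝ u x - fderiv ℝ u y‖ ≤ C * ‖x - y‖ ^ (2 * s + ε - 1))

/-- The fundamental solution: `a(n,s) |x|^(2s-n)` with
`a(n,s) = Γ(n/2 - s) / (2^(2s) π^(n/2) Γ(s))` if `n ≠ 2s`, and `-(1/π) log |x|` if `n = 2s`. -/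
def fundSol {n : ℕ} (s : ℝ) (x : EuclideanSpace ℝ (Fin n)) : ℝ :=
  open scoped Classical in
  if (n : ℝ) = 2 * s then
    -(1 / Real.pi) * Real.log ‖x‖
  else
    Real.Gamma ((n : ℝ) / 2 - s) /
        ((2 : ℝ) ^ (2 * s) * Real.pi ^ ((n : ℝ) / 2) * Real.Gamma s) *
      ‖x‖ ^ (2 * s - (n : ℝ))

/-- The function `u = Φ * f`, that is `u(x) = ∫ Φ(y) f(x-y) dy`. -/
def poissonSol {n : ℕ} (s : ℝ) (f : EuclideanSpace ℝ (Fin n) → ℝ) :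
    EuclideanSpace ℝ (Fin n) → ℝ :=
  convolution (fundSol s) f (ContinuousLinearMap.mul ℝ ℝ) volume

end

end FracLap

/-! The operator is handled throughout in symmetrized form. Averaging the truncated integrals over
`y ↦ -y` turns the principal value into half of `symmIntegral`, the integral of `2u(x) - u(x+y) -
u(x-y)` against `‖y‖^(-(n+2s))`. This converges absolutely once second differences are `O(‖y‖^b)`
with `b > 2s` and `u` grows at most like `(1+‖x‖)^σ` with `σ < 2s`
(`hasFracLaplacianAt_of_integrable`, `integrable_symm_of_growth`).

The core is the identity `Φ * (-Δ)^s φ = φ` for Schwartz `φ`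
(`integral_fundSol_mul_schwartzFracLap`). Write `Φ` as a superposition of Gaussians, `A ∫ t^(q-1)
(exp(-t‖z‖²) - c(t)) dt` with `q = n/2 - s`. The compensator `c` is needed only if `q ≤ 0`, and it
drops out because `(-Δ)^s φ` has integral zero. On the Fourier side `(-Δ)^s` is multiplication by
`|2πξ|^(2s)`, with no further constant by the choice of `C(n,s)` (`normConst_mul_cosIntegral`). The
Gaussian at scale `t` contributes `(π/t)^(n/2) exp(-π²|ξ|²/t)`, and the integral over `t` of the
product is `1/A` for every `ξ ≠ 0`. Fourier inversion then returns `φ`. Since `Φ` is even and `u`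
grows slowly, Fubini turns this identity into the distributional equation for `u = Φ * f`.

For regularity, derivatives and differences fall on `f`. Differences of translates of `f`, and `∇f`,
have mean zero, so any constant may be subtracted from `Φ`. Hence only the mean oscillation of `Φ`
on balls of fixed radius matters, and this is bounded even when `Φ` itself is not
(`exists_integral_abs_fundSol_sub_le`). So `u` inherits the Hölder class of `f`
(`memHolder_poissonSol`).

For the pointwise equation, `u` now has second differences `O(‖y‖^(2s+ε))`, so its symmetrized
integral exists everywhere and is continuous. The symmetrized integral is a symmetric operator
(`integral_symmIntegral_mul`), so tested against any `φ` it agrees with `f`. Two continuous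
functions that agree as distributions are equal. -/

namespace FracLap

noncomputable section

/-! ### Radial functions -/

section Radial

variable {E : Type*} [NormedAddCommGroup E]

/-- The radial function `‖y‖ ^ b` on the closed unit ball, `‖y‖ ^ g` outside of it. -/
def radialPow (b g : ℝ) (y : E) : ℝ := if ‖y‖ ≤ 1 then ‖y‖ ^ b else ‖y‖ ^ g

lemma radialPow_nonneg (b g : ℝ) (y : E) : 0 ≤ radialPow b g y := by
  unfold radialPow; split_ifs <;> positivity

variable [MeasurableSpace E] [BorelSpace E]

variable [NormedSpace ℝ E] [FiniteDimensional ℝ E] (μ : Measure E) [μ.IsAddHaarMeasure]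

/-- In polar coordinates the two pieces become one-dimensional powers with exponents `d - 1 + b >
-1` at the origin and `d - 1 + g < -1` at infinity. This function is the common majorant for the
singular integrals below. -/
lemma integrable_radialPow [Nontrivial E] {b g : ℝ} (hb : -(Module.finrank ℝ E : ℝ) < b)
    (hg : g < -(Module.finrank ℝ E : ℝ)) : Integrable (radialPow b g : E → ℝ) μ := by
  have hd : 1 ≤ Module.finrank ℝ E := Module.finrank_pos
  have key : Integrable (fun x : E => (fun r : ℝ => if r ≤ 1 then r ^ b else r ^ g) ‖x‖) μ := by
    refine (integrable_fun_norm_addHaar μ (f := fun r : ℝ => if r ≤ 1 then r ^ b else r ^ g)).2 ?_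
    have e : ∀ c : ℝ, ∀ r : ℝ, 0 < r → r ^ (Module.finrank ℝ E - 1) • r ^ c
        = r ^ ((Module.finrank ℝ E : ℝ) - 1 + c) := by
      intro c r hr
      rw [Real.rpow_add hr, ← Real.rpow_natCast, smul_eq_mul, Nat.cast_sub hd, Nat.cast_one]
    rw [← Set.Ioc_union_Ioi_eq_Ioi (zero_le_one (α := ℝ)), integrableOn_union]
    constructor
    · have h1 : IntegrableOn (fun r : ℝ => r ^ ((Module.finrank ℝ E : ℝ) - 1 + b))
          (Set.Ioc 0 1) := by
        rw [← intervalIntegrable_iff_integrableOn_Ioc_of_le zero_le_one]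
        exact intervalIntegral.intervalIntegrable_rpow' (by linarith)
      refine h1.congr_fun (fun r hr => ?_) measurableSet_Ioc
      simp only [if_pos hr.2]
      exact (e b r hr.1).symm
    · have h1 : IntegrableOn (fun r : ℝ => r ^ ((Module.finrank ℝ E : ℝ) - 1 + g))
          (Set.Ioi 1) := integrableOn_Ioi_rpow_of_lt (by linarith) one_pos
      refine h1.congr_fun (fun r hr => ?_) measurableSet_Ioi
      have : ¬ r ≤ 1 := not_le.mpr hr
      simp only [if_neg this]
      exact (e g r (lt_trans one_pos hr)).symm
  exact key

end Radial

/-! ### Second differences -/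

section SecondDiff

variable {E : Type*} [NormedAddCommGroup E] {F : Type*} [NormedAddCommGroup F] [NormedSpace ℝ F]

/-- The symmetric second difference `2 u(x) - u(x+y) - u(x-y)`. -/
def secondDiff (u : E → F) (x y : E) : F := (2 : ℝ) • u x - u (x + y) - u (x - y)

lemma norm_secondDiff_le (u : E → F) (x y : E) :
    ‖secondDiff u x y‖ ≤ 2 * ‖u x‖ + ‖u (x + y)‖ + ‖u (x - y)‖ := by
  unfold secondDiff
  refine (norm_sub_le _ _).trans (add_le_add_left ((norm_sub_le _ _).trans ?_) _)
  rw [norm_smul]; simp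

lemma norm_secondDiff_le_diff (u : E → F) (x y : E) :
    ‖secondDiff u x y‖ ≤ ‖u x - u (x + y)‖ + ‖u x - u (x - y)‖ := by
  have : secondDiff u x y = (u x - u (x + y)) + (u x - u (x - y)) := by
    simp only [secondDiff, two_smul]; abel
  rw [this]; exact norm_add_le _ _

variable [NormedSpace ℝ E]

/-- Mean value inequality on `[0, 1]` for `t ↦ u(x+ty) + u(x-ty)`, whose derivative is the
difference of the two differentials applied to `y`. -/
lemma norm_secondDiff_le_of_fderiv {u : E → F} (hu : Differentiable ℝ u) {x y : E} {B : ℝ}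
    (hB : ∀ t ∈ Set.Icc (0 : ℝ) 1, ‖fderiv ℝ u (x + t • y) - fderiv ℝ u (x - t • y)‖ ≤ B) :
    ‖secondDiff u x y‖ ≤ B * ‖y‖ := by
  set g : ℝ → F := fun t => u (x + t • y) + u (x - t • y) with hg
  have hd : ∀ t : ℝ, HasDerivAt g
      ((fderiv ℝ u (x + t • y) - fderiv ℝ u (x - t • y)) y) t := by
    intro t
    have h1 : HasDerivAt (fun t : ℝ => x + t • y) y t := by
      simpa using ((hasDerivAt_id t).smul_const y).const_add x
    have h2 : HasDerivAt (fun t : ℝ => x - t • y) (-y) t := by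
      simpa using ((hasDerivAt_id t).smul_const y).const_sub x
    have h3 := (hu (x + t • y)).hasFDerivAt.comp_hasDerivAt t h1
    have h4 := (hu (x - t • y)).hasFDerivAt.comp_hasDerivAt t h2
    have h5 := h3.add h4
    convert! h5 using 1
    simp [sub_eq_add_neg]
  have := (convex_Icc (0 : ℝ) 1).norm_image_sub_le_of_norm_hasDerivWithin_le
    (f := g) (C := B * ‖y‖) (fun t ht => (hd t).hasDerivWithinAt)
    (fun t ht => (ContinuousLinearMap.le_opNorm _ _).trans
      (mul_le_mul_of_nonneg_right (hB t ht) (norm_nonneg _)))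
    (Set.left_mem_Icc.2 zero_le_one) (Set.right_mem_Icc.2 zero_le_one)
  have e : secondDiff u x y = -(g 1 - g 0) := by
    simp only [hg, secondDiff, two_smul, one_smul, zero_smul, add_zero, sub_zero]; abel
  rw [e, norm_neg]
  simpa using this

lemma norm_secondDiff_le_of_fderiv_fderiv {u : E → F} (hu : ContDiff ℝ 2 u) {x y : E} {B : ℝ}
    (hB : ∀ z, ‖z - x‖ ≤ ‖y‖ → ‖fderiv ℝ (fderiv ℝ u) z‖ ≤ B) :
    ‖secondDiff u x y‖ ≤ 2 * B * ‖y‖ ^ 2 := by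
  have hd : Differentiable ℝ (fderiv ℝ u) :=
    (hu.fderiv_right (m := 1) (by norm_num)).differentiable (by norm_num)
  have hB0 : 0 ≤ B := (norm_nonneg (fderiv ℝ (fderiv ℝ u) x)).trans (hB x (by simp))
  have := norm_secondDiff_le_of_fderiv (u := u) (x := x) (y := y) (B := B * (2 * ‖y‖))
    (hu.differentiable (by norm_num)) (by
      intro t ht
      have hty : ‖t • y‖ ≤ ‖y‖ := by
        rw [norm_smul, Real.norm_of_nonneg ht.1]
        exact mul_le_of_le_one_left (norm_nonneg _) ht.2
      have := (convex_closedBall x ‖y‖).norm_image_sub_le_of_norm_fderiv_le (𝕜 := ℝ)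
        (f := fderiv ℝ u) (C := B) (x := x - t • y) (y := x + t • y)
        (fun z _ => hd z) (fun z hz => hB z (by simpa [dist_eq_norm] using hz))
        (by simpa [dist_eq_norm] using hty) (by simpa [dist_eq_norm] using hty)
      refine this.trans (mul_le_mul_of_nonneg_left ?_ hB0)
      have e : x + t • y - (x - t • y) = t • y + t • y := by abel
      rw [e, two_mul]
      exact (norm_add_le _ _).trans (add_le_add hty hty))
  refine this.trans (le_of_eq (by ring))

end SecondDiff

/-! ### Second differences of Schwartz functions -/

lemma one_add_norm_le_mul {E : Type*} [NormedAddCommGroup E] (x y : E) : 1 + ‖x‖ ≤ (1 + ‖x + y‖) * (1 + ‖y‖) := by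
  have : ‖x‖ ≤ ‖x + y‖ + ‖y‖ := by simpa using norm_sub_le (x + y) y
  nlinarith [norm_nonneg (x + y), norm_nonneg y]

lemma one_add_norm_rpow_le_mul {E : Type*} [NormedAddCommGroup E] {p : ℝ} (hp : 0 ≤ p) (x y : E) :
    (1 + ‖x‖) ^ p ≤ (1 + ‖x + y‖) ^ p * (1 + ‖y‖) ^ p := by
  rw [← Real.mul_rpow (by positivity) (by positivity)]
  exact Real.rpow_le_rpow (by positivity) (one_add_norm_le_mul x y) hp

section Schwartz

variable {E : Type*} [NormedAddCommGroup E] [NormedSpace ℝ E]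
  {F : Type*} [NormedAddCommGroup F] [NormedSpace ℝ F]

lemma exists_rpow_mul_norm_le (φ : 𝓢(E, F)) (r : ℝ) :
    ∃ C : ℝ, 0 ≤ C ∧ ∀ x, (1 + ‖x‖) ^ r * ‖φ x‖ ≤ C := by
  obtain ⟨k, hk⟩ := exists_nat_ge r
  have h := fun x => SchwartzMap.one_add_le_sup_seminorm_apply (𝕜 := ℝ) (m := (k, 0)) le_rfl
    le_rfl φ x
  simp only [norm_iteratedFDeriv_zero] at h
  refine ⟨_, le_trans (by positivity) (h 0), fun x => le_trans ?_ (h x)⟩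
  gcongr
  rw [← Real.rpow_natCast]
  exact Real.rpow_le_rpow_of_exponent_le (by simp) hk

lemma exists_norm_le_rpow (φ : 𝓢(E, F)) (r : ℝ) :
    ∃ C : ℝ, 0 ≤ C ∧ ∀ x, ‖φ x‖ ≤ C * (1 + ‖x‖) ^ (-r) := by
  obtain ⟨C, h0, h⟩ := exists_rpow_mul_norm_le φ r
  refine ⟨C, h0, fun x => ?_⟩
  have hx : 0 < 1 + ‖x‖ := by positivity
  rw [Real.rpow_neg hx.le, ← div_eq_mul_inv, le_div_iff₀ (by positivity), mul_comm]
  exact h x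

/-- The second difference of a function divided by `‖y‖ ^ p`, weighted by `(1 + ‖x‖) ^ p`. -/
lemma exists_weight_mul_secondDiff_le (φ : 𝓢(E, F)) {p : ℝ} (hp : 0 ≤ p) (m : ℝ) :
    ∃ C : ℝ, 0 ≤ C ∧ ∀ x y, (1 + ‖x‖) ^ p * ((‖y‖ ^ p)⁻¹ * ‖secondDiff φ x y‖) ≤
      C * (radialPow (2 - p) (-p) y + (1 + ‖x + y‖) ^ (-m) + (1 + ‖x - y‖) ^ (-m)) := by
  obtain ⟨A, hA0, hA⟩ := exists_rpow_mul_norm_le φ (p + m)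
  obtain ⟨A', hA'0, hA'⟩ := exists_rpow_mul_norm_le φ p
  obtain ⟨B, hB0, hB⟩ := exists_norm_le_rpow
    (SchwartzMap.fderivCLM ℝ _ _ (SchwartzMap.fderivCLM ℝ E F φ)) p
  have hB' : ∀ x, ‖fderiv ℝ (fderiv ℝ φ) x‖ ≤ B * (1 + ‖x‖) ^ (-p) := hB
  set C := 2 ^ p * (2 * B) + 2 * A' + 2 ^ p * A with hC
  have h2p : (0 : ℝ) ≤ 2 ^ p := by positivity
  have hC1 : 2 ^ p * (2 * B) ≤ C := by rw [hC]; linarith [mul_nonneg h2p hA0]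
  have hC2 : 2 * A' ≤ C := by rw [hC]; linarith [mul_nonneg h2p hA0, mul_nonneg h2p hB0]
  have hC3 : 2 ^ p * A ≤ C := by rw [hC]; linarith [mul_nonneg h2p hB0]
  have hC0 : 0 ≤ C := le_trans (by positivity) hC2
  refine ⟨C, hC0, fun x y => ?_⟩
  have hx : 0 < 1 + ‖x‖ := by positivity
  rcases le_or_gt ‖y‖ 1 with hy | hy
  · have hr : radialPow (2 - p) (-p) y = ‖y‖ ^ (2 - p) := by rw [radialPow, if_pos hy]
    -- For `‖y‖ ≤ 1` every point `z` within `‖y‖` of `x` satisfies `1 + ‖x‖ ≤ 2 (1 + ‖z‖)`, so the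
    -- decay of the second derivative at `z` is decay in `x`, at the cost of `2 ^ p`.
    have h1 : ‖secondDiff φ x y‖ ≤ 2 * (B * (2 ^ p * (1 + ‖x‖) ^ (-p))) * ‖y‖ ^ 2 := by
      refine norm_secondDiff_le_of_fderiv_fderiv (φ.smooth 2) fun z hz => (hB' z).trans ?_
      gcongr
      have hz0 : 0 < 1 + ‖z‖ := by positivity
      rw [Real.rpow_neg hz0.le, Real.rpow_neg hx.le, ← div_eq_mul_inv,
        le_div_iff₀ (by positivity), inv_mul_le_iff₀ (by positivity),
        ← Real.mul_rpow hz0.le (by norm_num)]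
      refine Real.rpow_le_rpow hx.le ?_ hp
      have : ‖x‖ ≤ ‖z‖ + ‖z - x‖ := by
        have := norm_sub_le z (z - x); simpa using this
      linarith [norm_nonneg z]
    rcases eq_or_ne y 0 with rfl | hy0
    · have : secondDiff φ x 0 = 0 := by simp [secondDiff, two_smul]
      simp only [this, norm_zero (E := F), mul_zero]
      have := radialPow_nonneg (2 - p) (-p) (0 : E)
      positivity
    have hy0' : 0 < ‖y‖ := norm_pos_iff.2 hy0
    calc (1 + ‖x‖) ^ p * ((‖y‖ ^ p)⁻¹ * ‖secondDiff φ x y‖)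
        ≤ (1 + ‖x‖) ^ p * ((‖y‖ ^ p)⁻¹ * (2 * (B * (2 ^ p * (1 + ‖x‖) ^ (-p))) * ‖y‖ ^ 2)) := by
          gcongr
      _ = (2 ^ p * (2 * B)) * ‖y‖ ^ (2 - p) := by
          rw [Real.rpow_sub hy0', Real.rpow_neg hx.le]
          have : (1 + ‖x‖) ^ p ≠ 0 := by positivity
          have e : ‖y‖ ^ (2 : ℝ) = ‖y‖ ^ 2 := by norm_cast
          rw [e]
          field_simp
      _ ≤ C * ‖y‖ ^ (2 - p) := by gcongr
      _ ≤ _ := by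
          rw [hr]; gcongr
          have : 0 ≤ (1 + ‖x + y‖) ^ (-m) := by positivity
          have : 0 ≤ (1 + ‖x - y‖) ^ (-m) := by positivity
          linarith
  · have hr : radialPow (2 - p) (-p) y = ‖y‖ ^ (-p) := by rw [radialPow, if_neg (not_le.2 hy)]
    have hy0 : 0 < ‖y‖ := by linarith
    -- For `‖y‖ > 1`, `1 + ‖x‖ ≤ (1 + ‖z‖) (2‖y‖)`. The factor `‖y‖ ^ p` cancels the kernel and `(1
    -- + ‖z‖) ^ p` is absorbed by the decay of `φ`, which is taken with `m` orders to spare.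
    have key : ∀ z, ‖z - x‖ ≤ ‖y‖ →
        (1 + ‖x‖) ^ p * ((‖y‖ ^ p)⁻¹ * ‖φ z‖) ≤ 2 ^ p * A * (1 + ‖z‖) ^ (-m) := by
      intro z hz
      have hz0 : 0 < 1 + ‖z‖ := by positivity
      have h1 : (1 + ‖x‖) ^ p ≤ (1 + ‖z‖) ^ p * (2 * ‖y‖) ^ p := by
        rw [← Real.mul_rpow (by positivity) (by positivity)]
        refine Real.rpow_le_rpow hx.le ?_ hp
        have : ‖x‖ ≤ ‖z‖ + ‖z - x‖ := by
          have := norm_sub_le z (z - x); simpa using this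
        nlinarith [norm_nonneg z]
      have h2 : ‖φ z‖ ≤ A * ((1 + ‖z‖) ^ p)⁻¹ * (1 + ‖z‖) ^ (-m) := by
        have := hA z
        rw [mul_comm, Real.rpow_add hz0, ← le_div_iff₀ (by positivity)] at this
        refine this.trans (le_of_eq ?_)
        rw [Real.rpow_neg hz0.le]
        field_simp
      calc (1 + ‖x‖) ^ p * ((‖y‖ ^ p)⁻¹ * ‖φ z‖)
          ≤ ((1 + ‖z‖) ^ p * (2 * ‖y‖) ^ p) * ((‖y‖ ^ p)⁻¹ *
            (A * ((1 + ‖z‖) ^ p)⁻¹ * (1 + ‖z‖) ^ (-m))) := by gcongr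
        _ = _ := by
          rw [Real.mul_rpow (by norm_num) hy0.le]
          have : (1 + ‖z‖) ^ p ≠ 0 := by positivity
          have : ‖y‖ ^ p ≠ 0 := by positivity
          field_simp
    have k1 := key (x + y) (by simp)
    have k2 := key (x - y) (by simp)
    have k0 : (1 + ‖x‖) ^ p * ((‖y‖ ^ p)⁻¹ * (2 * ‖φ x‖)) ≤ 2 * A' * ‖y‖ ^ (-p) := by
      rw [Real.rpow_neg hy0.le]
      calc _ = 2 * ((1 + ‖x‖) ^ p * ‖φ x‖) * (‖y‖ ^ p)⁻¹ := by ring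
        _ ≤ _ := by gcongr; exact hA' x
    calc (1 + ‖x‖) ^ p * ((‖y‖ ^ p)⁻¹ * ‖secondDiff φ x y‖)
        ≤ (1 + ‖x‖) ^ p * ((‖y‖ ^ p)⁻¹ * (2 * ‖φ x‖ + ‖φ (x + y)‖ + ‖φ (x - y)‖)) := by
          gcongr; exact norm_secondDiff_le _ _ _
      _ ≤ 2 * A' * ‖y‖ ^ (-p) + 2 ^ p * A * (1 + ‖x + y‖) ^ (-m)
          + 2 ^ p * A * (1 + ‖x - y‖) ^ (-m) := by
          rw [mul_add, mul_add, mul_add, mul_add]; gcongr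
      _ ≤ C * ‖y‖ ^ (-p) + C * (1 + ‖x + y‖) ^ (-m) + C * (1 + ‖x - y‖) ^ (-m) := by gcongr
      _ = _ := by rw [hr]; ring

/-- The majorant does not depend on `x`, as is needed to differentiate under the integral sign. -/
lemma exists_secondDiff_le (φ : 𝓢(E, F)) (p : ℝ) :
    ∃ C : ℝ, 0 ≤ C ∧ ∀ x y, (‖y‖ ^ p)⁻¹ * ‖secondDiff φ x y‖ ≤
      C * radialPow (2 - p) (-p) y := by
  obtain ⟨A, hA0, hA⟩ := exists_norm_le_rpow φ 0
  obtain ⟨B, hB0, hB⟩ := exists_norm_le_rpow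
    (SchwartzMap.fderivCLM ℝ _ _ (SchwartzMap.fderivCLM ℝ E F φ)) 0
  simp only [neg_zero, Real.rpow_zero, mul_one] at hA hB
  have hB' : ∀ x, ‖fderiv ℝ (fderiv ℝ φ) x‖ ≤ B := hB
  refine ⟨2 * B + 4 * A, by positivity, fun x y => ?_⟩
  rcases le_or_gt ‖y‖ 1 with hy | hy
  · rw [radialPow, if_pos hy]
    rcases eq_or_ne y 0 with rfl | hy0
    · have : secondDiff φ x 0 = 0 := by simp [secondDiff, two_smul]
      simp only [this, norm_zero (E := F), mul_zero]
      positivity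
    have hy0' : 0 < ‖y‖ := norm_pos_iff.2 hy0
    calc (‖y‖ ^ p)⁻¹ * ‖secondDiff φ x y‖ ≤ (‖y‖ ^ p)⁻¹ * (2 * B * ‖y‖ ^ 2) := by
          gcongr
          exact norm_secondDiff_le_of_fderiv_fderiv (φ.smooth 2) fun z _ => hB' z
      _ = 2 * B * ‖y‖ ^ (2 - p) := by
          have e : ‖y‖ ^ (2 : ℝ) = ‖y‖ ^ 2 := by norm_cast
          rw [Real.rpow_sub hy0', e]
          field_simp
      _ ≤ _ := by gcongr; linarith
  · rw [radialPow, if_neg (not_le.2 hy), Real.rpow_neg (norm_nonneg _), mul_comm]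
    gcongr
    have := norm_secondDiff_le φ x y
    linarith [hA x, hA (x + y), hA (x - y)]

end Schwartz

/-! ### The symmetrized singular integral of a Schwartz function -/

/-- The symmetrized singular integral `∫ (2 u(x) - u(x+y) - u(x-y)) / ‖y‖ ^ p dy`. -/
def symmIntegral {E : Type*} [NormedAddCommGroup E] [MeasureSpace E]
    {F : Type*} [NormedAddCommGroup F] [NormedSpace ℝ F] (p : ℝ) (u : E → F) (x : E) : F :=
  ∫ y, (‖y‖ ^ p)⁻¹ • secondDiff u x y

lemma integrable_rpow_one_add_norm {n : ℕ} {r : ℝ} (hr : (n : ℝ) < r) :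
    Integrable (fun x : EuclideanSpace ℝ (Fin n) => (1 + ‖x‖) ^ (-r)) :=
  integrable_one_add_norm (by simpa using hr)

lemma aestronglyMeasurable_symm {n : ℕ} {p : ℝ} {F : Type*} [NormedAddCommGroup F]
    [NormedSpace ℝ F] {u : EuclideanSpace ℝ (Fin n) → F} (hu : Continuous u)
    (x : EuclideanSpace ℝ (Fin n)) :
    AEStronglyMeasurable (fun y => (‖y‖ ^ p)⁻¹ • secondDiff u x y) := by
  refine AEStronglyMeasurable.smul ?_ ?_
  · exact ((measurable_norm.pow_const p).inv).aestronglyMeasurable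
  · unfold secondDiff; fun_prop

section

variable {n : ℕ} [NeZero n] {p : ℝ}

lemma integrable_radialPow_euclidean {b g : ℝ} (hb : -(n : ℝ) < b) (hg : g < -(n : ℝ)) :
    Integrable (radialPow b g : EuclideanSpace ℝ (Fin n) → ℝ) := by
  have : Nonempty (Fin n) := ⟨0⟩
  exact integrable_radialPow volume (by simpa using hb) (by simpa using hg)

variable {F : Type} [NormedAddCommGroup F] [NormedSpace ℝ F]

lemma integrable_symm_schwartz (hp1 : (n : ℝ) < p) (hp2 : p < n + 2)
    (φ : 𝓢(EuclideanSpace ℝ (Fin n), F)) (x : EuclideanSpace ℝ (Fin n)) :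
    Integrable (fun y => (‖y‖ ^ p)⁻¹ • secondDiff φ x y) := by
  obtain ⟨C, hC0, hC⟩ := exists_secondDiff_le φ p
  refine Integrable.mono' ((integrable_radialPow_euclidean (b := 2 - p) (g := -p)
    (by linarith) (by linarith)).const_mul C) (aestronglyMeasurable_symm φ.continuous x) ?_
  filter_upwards with y
  rw [norm_smul, Real.norm_of_nonneg (by positivity)]
  exact hC x y

/-- Second differences commute with differentiation in `x`, and the derivative of `φ` is again
Schwartz, so the differentiated integrand has an integrable majorant uniform in `x`. -/
lemma hasFDerivAt_symmIntegral (hp1 : (n : ℝ) < p) (hp2 : p < n + 2)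
    (φ : 𝓢(EuclideanSpace ℝ (Fin n), F)) (x : EuclideanSpace ℝ (Fin n)) :
    HasFDerivAt (symmIntegral p φ)
      (symmIntegral p (SchwartzMap.fderivCLM ℝ (EuclideanSpace ℝ (Fin n)) F φ) x) x := by
  set φ' := SchwartzMap.fderivCLM ℝ (EuclideanSpace ℝ (Fin n)) F φ
  obtain ⟨C, hC0, hC⟩ := exists_secondDiff_le φ' p
  refine hasFDerivAt_integral_of_dominated_of_fderiv_le (s := Set.univ)
    (bound := fun y => C * radialPow (2 - p) (-p) y)
    (F' := fun x y => (‖y‖ ^ p)⁻¹ • secondDiff φ' x y) univ_mem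
    (Eventually.of_forall fun x => aestronglyMeasurable_symm φ.continuous x)
    (integrable_symm_schwartz hp1 hp2 φ x) (aestronglyMeasurable_symm φ'.continuous x) ?_
    ((integrable_radialPow_euclidean (by linarith) (by linarith)).const_mul C) ?_
  · filter_upwards with y x _
    rw [norm_smul, Real.norm_of_nonneg (by positivity)]
    exact hC x y
  · filter_upwards with y x _
    have h : ∀ z, HasFDerivAt φ (φ' z) z := fun z => φ.differentiableAt.hasFDerivAt
    have h1 : HasFDerivAt (fun x => φ (x + y)) (φ' (x + y)) x := by
      simpa [Function.comp_def] using! (h (x + y)).comp x ((hasFDerivAt_id x).add_const y)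
    have h2 : HasFDerivAt (fun x => φ (x - y)) (φ' (x - y)) x := by
      simpa [Function.comp_def] using! (h (x - y)).comp x ((hasFDerivAt_id x).sub_const y)
    exact ((((h x).const_smul (2 : ℝ)).sub h1).sub h2).const_smul _

/-- The weighted `L¹` bound for the symmetrized integrand of a Schwartz function. -/
lemma exists_weight_mul_integral_le (hp1 : (n : ℝ) < p) (hp2 : p < n + 2)
    (φ : 𝓢(EuclideanSpace ℝ (Fin n), F)) :
    ∃ C : ℝ, 0 ≤ C ∧ ∀ x,
      (1 + ‖x‖) ^ p * ∫ y, ‖(‖y‖ ^ p)⁻¹ • secondDiff φ x y‖ ≤ C := by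
  have hp : 0 ≤ p := le_trans (Nat.cast_nonneg n) hp1.le
  obtain ⟨C, hC0, hC⟩ := exists_weight_mul_secondDiff_le φ hp (n + 1)
  have hW := integrable_rpow_one_add_norm (n := n) (r := n + 1) (by linarith)
  have hR := integrable_radialPow_euclidean (n := n) (b := 2 - p) (g := -p)
    (by linarith) (by linarith)
  set W : EuclideanSpace ℝ (Fin n) → ℝ := fun x => (1 + ‖x‖) ^ (-((n : ℝ) + 1)) with hWdef
  refine ⟨C * ((∫ y, radialPow (2 - p) (-p) (y : EuclideanSpace ℝ (Fin n))) + (∫ y, W y)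
    + ∫ y, W y), ?_, fun x => ?_⟩
  · have : 0 ≤ ∫ y : EuclideanSpace ℝ (Fin n), radialPow (2 - p) (-p) y :=
      integral_nonneg fun y => radialPow_nonneg (2 - p) (-p) y
    have : 0 ≤ ∫ y, W y := integral_nonneg (fun y => by simp only [hWdef, Pi.zero_apply]; positivity)
    positivity
  · have h1 : Integrable (fun y => W (x + y)) := hW.comp_add_left x
    have h2 : Integrable (fun y => W (x - y)) := hW.comp_sub_left x
    calc (1 + ‖x‖) ^ p * ∫ y, ‖(‖y‖ ^ p)⁻¹ • secondDiff φ x y‖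
        = ∫ y, (1 + ‖x‖) ^ p * ‖(‖y‖ ^ p)⁻¹ • secondDiff φ x y‖ := by
          rw [integral_const_mul]
      _ ≤ ∫ y, C * (radialPow (2 - p) (-p) y + W (x + y) + W (x - y)) := by
          refine integral_mono ((integrable_symm_schwartz hp1 hp2 φ x).norm.const_mul _)
            (((hR.add h1).add h2).const_mul C) fun y => ?_
          simp only [norm_smul]
          rw [Real.norm_of_nonneg (by positivity)]
          exact hC x y
      _ = _ := by
          have e1 := integral_add (hR.add h1) h2
          have e2 := integral_add hR h1
          simp only [Pi.add_apply] at e1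
          rw [integral_const_mul, e1, e2,
            integral_add_left_eq_self W x, integral_sub_left_eq_self W volume x]

end

/-! ### Smoothness and decay of the symmetrized integral of a Schwartz function. -/

section

variable {n : ℕ} [NeZero n] {p : ℝ}

lemma fderiv_symmIntegral (hp1 : (n : ℝ) < p) (hp2 : p < n + 2)
    {F : Type} [NormedAddCommGroup F] [NormedSpace ℝ F] (φ : 𝓢(EuclideanSpace ℝ (Fin n), F)) :
    fderiv ℝ (symmIntegral p φ) =
      symmIntegral p (SchwartzMap.fderivCLM ℝ (EuclideanSpace ℝ (Fin n)) F φ) :=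
  funext fun x => (hasFDerivAt_symmIntegral hp1 hp2 φ x).fderiv

/-- Induction on `k` through `fderiv_symmIntegral`. Each step replaces `φ` by its derivative, whose
values lie in a space of linear maps, so the target space has to vary within the induction. -/
lemma contDiff_symmIntegral (hp1 : (n : ℝ) < p) (hp2 : p < n + 2) (k : ℕ) :
    ∀ {F : Type} [NormedAddCommGroup F] [NormedSpace ℝ F]
      (φ : 𝓢(EuclideanSpace ℝ (Fin n), F)), ContDiff ℝ k (symmIntegral p φ) := by
  induction k with
  | zero =>
    intro F _ _ φ
    refine contDiff_zero.2 (continuous_iff_continuousAt.2 fun x =>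
      (hasFDerivAt_symmIntegral hp1 hp2 φ x).continuousAt)
  | succ k ih =>
    intro F _ _ φ
    push_cast
    refine (contDiff_succ_iff_fderiv).2 ⟨fun x =>
      (hasFDerivAt_symmIntegral hp1 hp2 φ x).differentiableAt, by simp, ?_⟩
    rw [fderiv_symmIntegral hp1 hp2]
    exact ih _

lemma exists_iteratedFDeriv_symmIntegral_le (hp1 : (n : ℝ) < p) (hp2 : p < n + 2) (k : ℕ) :
    ∀ {F : Type} [NormedAddCommGroup F] [NormedSpace ℝ F]
      (φ : 𝓢(EuclideanSpace ℝ (Fin n), F)),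
      ∃ C : ℝ, ∀ x, (1 + ‖x‖) ^ p * ‖iteratedFDeriv ℝ k (symmIntegral p φ) x‖ ≤ C := by
  induction k with
  | zero =>
    intro F _ _ φ
    obtain ⟨C, -, hC⟩ := exists_weight_mul_integral_le hp1 hp2 φ
    refine ⟨C, fun x => le_trans ?_ (hC x)⟩
    rw [norm_iteratedFDeriv_zero]
    gcongr
    exact norm_integral_le_integral_norm _
  | succ k ih =>
    intro F _ _ φ
    obtain ⟨C, hC⟩ := ih (SchwartzMap.fderivCLM ℝ (EuclideanSpace ℝ (Fin n)) F φ)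
    refine ⟨C, fun x => ?_⟩
    rw [← norm_iteratedFDeriv_fderiv, fderiv_symmIntegral hp1 hp2]
    exact hC x

lemma memSs_symmIntegral {s : ℝ} (hs0 : 0 < s) (hs1 : s < 1) (c : ℝ)
    (φ : 𝓢(EuclideanSpace ℝ (Fin n), ℝ)) :
    MemSs s (fun x => c * symmIntegral ((n : ℝ) + 2 * s) φ x) := by
  have hp1 : (n : ℝ) < n + 2 * s := by linarith
  have hp2 : (n : ℝ) + 2 * s < n + 2 := by linarith
  have hcd : ContDiff ℝ ∞ (symmIntegral ((n : ℝ) + 2 * s) φ) :=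
    contDiff_infty.2 fun k => contDiff_symmIntegral hp1 hp2 k φ
  refine ⟨contDiff_const.mul hcd, fun k => ?_⟩
  obtain ⟨C, hC⟩ := exists_iteratedFDeriv_symmIntegral_le hp1 hp2 k φ
  refine ⟨2 * (|c| * C), fun x => ?_⟩
  have e : (fun x => c * symmIntegral ((n : ℝ) + 2 * s) φ x)
    = c • symmIntegral ((n : ℝ) + 2 * s) φ := rfl
  rw [e, iteratedFDeriv_const_smul_apply ((hcd.of_le (by exact_mod_cast le_top)).contDiffAt),
    norm_smul, Real.norm_eq_abs]
  have hp : 0 ≤ (n : ℝ) + 2 * s := by positivity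
  have h1 : 1 + ‖x‖ ^ ((n : ℝ) + 2 * s) ≤ 2 * (1 + ‖x‖) ^ ((n : ℝ) + 2 * s) := by
    have a1 : (1 : ℝ) ≤ (1 + ‖x‖) ^ ((n : ℝ) + 2 * s) := Real.one_le_rpow (by simp) hp
    have a2 : ‖x‖ ^ ((n : ℝ) + 2 * s) ≤ (1 + ‖x‖) ^ ((n : ℝ) + 2 * s) :=
      Real.rpow_le_rpow (norm_nonneg _) (by simp) hp
    linarith
  calc _ ≤ 2 * (1 + ‖x‖) ^ ((n : ℝ) + 2 * s) *
        (|c| * ‖iteratedFDeriv ℝ k (symmIntegral ((n : ℝ) + 2 * s) φ) x‖) := by gcongr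
    _ = 2 * (|c| * ((1 + ‖x‖) ^ ((n : ℝ) + 2 * s) *
        ‖iteratedFDeriv ℝ k (symmIntegral ((n : ℝ) + 2 * s) φ) x‖)) := by ring
    _ ≤ _ := by gcongr; exact hC x

end

/-! ### The principal value as a symmetrized integral -/

lemma abs_le_of_growth {E : Type*} [NormedAddCommGroup E] {u : E → ℝ} {A σ : ℝ} (hσ : 0 ≤ σ)
    (hA : 0 ≤ A) (hu : ∀ x, |u x| ≤ A * (1 + ‖x‖) ^ σ) (x y : E) :
    |u (x + y)| ≤ A * (1 + ‖x‖) ^ σ * (1 + ‖y‖) ^ σ := by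
  refine (hu _).trans ?_
  rw [mul_assoc]
  gcongr
  have := one_add_norm_rpow_le_mul hσ (x + y) (-y)
  simpa using this

lemma abs_le_of_growth_sub {E : Type*} [NormedAddCommGroup E] {u : E → ℝ} {A σ : ℝ} (hσ : 0 ≤ σ)
    (hA : 0 ≤ A) (hu : ∀ x, |u x| ≤ A * (1 + ‖x‖) ^ σ) (x y : E) :
    |u (x - y)| ≤ A * (1 + ‖x‖) ^ σ * (1 + ‖y‖) ^ σ := by
  simpa [sub_eq_add_neg] using abs_le_of_growth hσ hA hu x (-y)

section

variable {n : ℕ} {s σ A : ℝ} {u : EuclideanSpace ℝ (Fin n) → ℝ}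

lemma aestronglyMeasurable_symm_prod {p : ℝ} (huc : Continuous u) :
    AEStronglyMeasurable (fun z : EuclideanSpace ℝ (Fin n) × EuclideanSpace ℝ (Fin n) =>
      (‖z.2‖ ^ p)⁻¹ • secondDiff u z.1 z.2) := by
  simp only [secondDiff, smul_eq_mul]
  refine AEStronglyMeasurable.mul ?_ ?_
  · exact ((measurable_snd.norm.pow_const _).inv).aestronglyMeasurable
  · exact Continuous.aestronglyMeasurable (by fun_prop)

lemma integrable_indicator_difference (hσ : 0 ≤ σ) (hσs : σ < 2 * s) (hA : 0 ≤ A)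
    (huc : Continuous u) (hu : ∀ x, |u x| ≤ A * (1 + ‖x‖) ^ σ)
    (x : EuclideanSpace ℝ (Fin n)) {δ : ℝ} (hδ : 0 < δ) :
    Integrable ((Metric.ball (0 : EuclideanSpace ℝ (Fin n)) δ)ᶜ.indicator
      fun h => (u x - u (x - h)) / ‖h‖ ^ ((n : ℝ) + 2 * s)) := by
  set p : ℝ := (n : ℝ) + 2 * s with hp
  have hn : (0 : ℝ) ≤ n := Nat.cast_nonneg n
  have hp0 : 0 ≤ p := by rw [hp]; linarith
  have hms : MeasurableSet (Metric.ball (0 : EuclideanSpace ℝ (Fin n)) δ)ᶜ :=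
    measurableSet_ball.compl
  -- On `‖h‖ ≥ δ` one has `1 + ‖h‖ ≤ (1 + 1/δ) ‖h‖`, which replaces the kernel by a power of `1 +
  -- ‖h‖`; the factor `2` counts the two values of `u`.
  set K := 2 * (A * (1 + ‖x‖) ^ σ) * (1 + 1 / δ) ^ p with hK
  refine Integrable.mono' ((integrable_rpow_one_add_norm (n := n) (r := p - σ)
    (by rw [hp]; linarith)).const_mul K) ?_ ?_
  · refine AEStronglyMeasurable.indicator ?_ hms
    refine Measurable.aestronglyMeasurable ?_
    exact (measurable_const.sub (huc.comp (by fun_prop)).measurable).div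
      (measurable_norm.pow_const _)
  · filter_upwards with h
    by_cases hh : h ∈ (Metric.ball (0 : EuclideanSpace ℝ (Fin n)) δ)ᶜ
    · rw [Set.indicator_of_mem hh]
      have hδh : δ ≤ ‖h‖ := by simpa using hh
      have hh0 : 0 < ‖h‖ := lt_of_lt_of_le hδ hδh
      have h1 : (1 + ‖h‖) ^ p ≤ (1 + 1 / δ) ^ p * ‖h‖ ^ p := by
        rw [← Real.mul_rpow (by positivity) hh0.le]
        refine Real.rpow_le_rpow (by positivity) ?_ hp0
        have : 1 ≤ 1 / δ * ‖h‖ := by rw [one_div, inv_mul_eq_div, le_div_iff₀ hδ]; linarith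
        linarith
      have h2 : |u x - u (x - h)| ≤ 2 * (A * (1 + ‖x‖) ^ σ) * (1 + ‖h‖) ^ σ := by
        refine (abs_sub _ _).trans ?_
        have h3 := abs_le_of_growth_sub hσ hA hu x h
        have h4 : |u x| ≤ A * (1 + ‖x‖) ^ σ * (1 + ‖h‖) ^ σ :=
          (hu x).trans (le_mul_of_one_le_right (by positivity)
            (Real.one_le_rpow (by simp) hσ))
        linarith
      rw [Real.norm_eq_abs, abs_div, abs_of_nonneg (by positivity : 0 ≤ ‖h‖ ^ p),
        div_le_iff₀ (by positivity)]
      refine h2.trans ?_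
      have h5 : (1 + ‖h‖) ^ (-(p - σ)) = (1 + ‖h‖) ^ σ * ((1 + ‖h‖) ^ p)⁻¹ := by
        rw [← Real.rpow_neg (by positivity), ← Real.rpow_add (by positivity)]; congr 1; ring
      rw [h5, hK]
      have h6 : 1 ≤ (1 + 1 / δ) ^ p * ‖h‖ ^ p * ((1 + ‖h‖) ^ p)⁻¹ := by
        rw [← div_eq_mul_inv, le_div_iff₀ (by positivity), one_mul]; exact h1
      calc 2 * (A * (1 + ‖x‖) ^ σ) * (1 + ‖h‖) ^ σ
          ≤ 2 * (A * (1 + ‖x‖) ^ σ) * (1 + ‖h‖) ^ σ *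
            ((1 + 1 / δ) ^ p * ‖h‖ ^ p * ((1 + ‖h‖) ^ p)⁻¹) :=
            le_mul_of_one_le_right (by positivity) h6
        _ = _ := by ring
    · rw [Set.indicator_of_notMem hh, norm_zero]
      positivity

/-- The complement of a ball centred at the origin is invariant under `h ↦ -h`, so each truncated
integral is half the truncated integral of the second difference. The latter is absolutely
integrable, and dominated convergence removes the truncation. -/
lemma hasFracLaplacianAt_of_integrable [NeZero n] (hσ : 0 ≤ σ) (hσs : σ < 2 * s) (hA : 0 ≤ A)
    (huc : Continuous u) (hu : ∀ x, |u x| ≤ A * (1 + ‖x‖) ^ σ) (x : EuclideanSpace ℝ (Fin n))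
    (hint : Integrable fun y => (‖y‖ ^ ((n : ℝ) + 2 * s))⁻¹ • secondDiff u x y) :
    HasFracLaplacianAt s u x
      (normConst n s / 2 * symmIntegral ((n : ℝ) + 2 * s) u x) := by
  set p : ℝ := (n : ℝ) + 2 * s with hp
  set g : EuclideanSpace ℝ (Fin n) → ℝ := fun h => (u x - u (x - h)) / ‖h‖ ^ p with hg
  set H : EuclideanSpace ℝ (Fin n) → ℝ := fun y => (‖y‖ ^ p)⁻¹ • secondDiff u x y with hH
  have hG : ∀ δ : ℝ, 0 < δ → Integrable
      ((Metric.ball (0 : EuclideanSpace ℝ (Fin n)) δ)ᶜ.indicator g) := fun δ hδ =>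
    integrable_indicator_difference hσ hσs hA huc hu x hδ
  have hms : ∀ (x : EuclideanSpace ℝ (Fin n)) (δ : ℝ),
      MeasurableSet (Metric.ball x δ)ᶜ := fun x δ => measurableSet_ball.compl
  have hshift : ∀ δ : ℝ, (fun y => (Metric.ball (0 : EuclideanSpace ℝ (Fin n)) δ)ᶜ.indicator g
      (x - y)) = (Metric.ball x δ)ᶜ.indicator fun y => (u x - u y) / ‖x - y‖ ^ p := by
    intro δ
    ext y
    simp only [Set.indicator, Set.mem_compl_iff, Metric.mem_ball, hg, sub_sub_cancel,
      dist_eq_norm, sub_zero, norm_sub_rev x y]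
  refine ⟨fun δ hδ => ?_, ?_⟩
  · rw [← integrable_indicator_iff (hms x δ), ← hshift]
    exact (hG δ hδ).comp_sub_left x
  have htr : ∀ δ : ℝ, 0 < δ → truncFracLaplacian s δ u x = normConst n s / 2 *
      ∫ y, (Metric.ball (0 : EuclideanSpace ℝ (Fin n)) δ)ᶜ.indicator H y := by
    intro δ hδ
    have e1 : ∫ y in (Metric.ball x δ)ᶜ, (u x - u y) / ‖x - y‖ ^ p
        = ∫ y, (Metric.ball (0 : EuclideanSpace ℝ (Fin n)) δ)ᶜ.indicator g y := by
      rw [← integral_indicator (hms x δ), ← hshift, integral_sub_left_eq_self _ volume x]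
    have e2 : ∫ y, (Metric.ball (0 : EuclideanSpace ℝ (Fin n)) δ)ᶜ.indicator H y
        = 2 * ∫ y, (Metric.ball (0 : EuclideanSpace ℝ (Fin n)) δ)ᶜ.indicator g y := by
      have e3 := integral_add (hG δ hδ) (hG δ hδ).comp_neg
      rw [integral_neg_eq_self ((Metric.ball (0 : EuclideanSpace ℝ (Fin n)) δ)ᶜ.indicator g)
        volume, ← two_mul] at e3
      rw [← e3]
      congr 1
      ext y
      simp only [Set.indicator, Set.mem_compl_iff, Metric.mem_ball, dist_zero_right, norm_neg, hg,
        hH, secondDiff, smul_eq_mul, sub_neg_eq_add]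
      split_ifs
      · simp
      · ring
    rw [truncFracLaplacian, e1, e2]
    ring
  have hlim : Tendsto (fun δ : ℝ => ∫ y,
      (Metric.ball (0 : EuclideanSpace ℝ (Fin n)) δ)ᶜ.indicator H y) (𝓝[>] 0) (𝓝 (∫ y, H y)) := by
    refine tendsto_integral_filter_of_dominated_convergence (fun y => ‖H y‖) ?_ ?_ hint.norm ?_
    · exact Eventually.of_forall fun δ => hint.aestronglyMeasurable.indicator (hms 0 δ)
    · refine Eventually.of_forall fun δ => Eventually.of_forall fun y => ?_
      exact norm_indicator_le_norm_self _ _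
    · filter_upwards with y
      rcases eq_or_ne y 0 with rfl | hy
      · have : H 0 = 0 := by simp [hH, secondDiff, two_mul]
        have e : ∀ δ : ℝ, (Metric.ball (0 : EuclideanSpace ℝ (Fin n)) δ)ᶜ.indicator H 0 = 0 := by
          intro δ
          by_cases h0 : (0 : EuclideanSpace ℝ (Fin n)) ∈ (Metric.ball 0 δ)ᶜ
          · rw [Set.indicator_of_mem h0, this]
          · rw [Set.indicator_of_notMem h0]
        simp only [e, this]
        exact tendsto_const_nhds
      · refine tendsto_const_nhds.congr' ?_
        have hy' : (0 : ℝ) < ‖y‖ := norm_pos_iff.2 hy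
        filter_upwards [nhdsWithin_le_nhds (Iio_mem_nhds hy')] with δ hδ
        rw [Set.indicator_of_mem]
        simpa using (le_of_lt hδ)
  refine (hlim.const_mul (normConst n s / 2)).congr' ?_
  filter_upwards [self_mem_nhdsWithin] with δ hδ
  exact (htr δ hδ).symm

/-! ### Functions of moderate growth with small second differences -/

/-- Inside the unit ball the bound on second differences is used, outside it the growth of `u`; the
two give the summands `H` and `4 * A * 2 ^ σ` of the constant. -/
lemma exists_secondDiff_le_growth {b p H : ℝ} (hσ : 0 ≤ σ) (hA : 0 ≤ A) (hH : 0 ≤ H)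
    (hu : ∀ x, |u x| ≤ A * (1 + ‖x‖) ^ σ)
    (hD : ∀ x y, |secondDiff u x y| ≤ H * ‖y‖ ^ b) :
    ∃ C : ℝ, 0 ≤ C ∧ ∀ x y, (‖y‖ ^ p)⁻¹ * |secondDiff u x y| ≤
      C * (1 + ‖x‖) ^ σ * radialPow (b - p) (σ - p) y := by
  refine ⟨H + 4 * A * 2 ^ σ, by positivity, fun x y => ?_⟩
  have h1 : 1 ≤ (1 + ‖x‖) ^ σ := Real.one_le_rpow (by simp) hσ
  rcases le_or_gt ‖y‖ 1 with hy | hy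
  · rw [radialPow, if_pos hy]
    rcases eq_or_ne y 0 with rfl | hy0
    · have : secondDiff u x 0 = 0 := by simp [secondDiff, two_mul]
      rw [this, abs_zero, mul_zero]
      positivity
    have hy' : 0 < ‖y‖ := norm_pos_iff.2 hy0
    calc (‖y‖ ^ p)⁻¹ * |secondDiff u x y| ≤ (‖y‖ ^ p)⁻¹ * (H * ‖y‖ ^ b) := by
          gcongr; exact hD x y
      _ = H * 1 * ‖y‖ ^ (b - p) := by rw [Real.rpow_sub hy']; field_simp
      _ ≤ _ := by
          gcongr
          have : 0 ≤ 4 * A * 2 ^ σ := by positivity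
          linarith
  · rw [radialPow, if_neg (not_le.2 hy)]
    have hy' : 0 < ‖y‖ := by linarith
    have h2 : (1 + ‖y‖) ^ σ ≤ 2 ^ σ * ‖y‖ ^ σ := by
      rw [← Real.mul_rpow (by norm_num) hy'.le]
      exact Real.rpow_le_rpow (by positivity) (by linarith) hσ
    have h3 : |secondDiff u x y| ≤ 4 * A * 2 ^ σ * (1 + ‖x‖) ^ σ * ‖y‖ ^ σ := by
      have a0 : |u x| ≤ A * (1 + ‖x‖) ^ σ * (1 + ‖y‖) ^ σ :=
        (hu x).trans (le_mul_of_one_le_right (by positivity) (Real.one_le_rpow (by simp) hσ))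
      have a1 := abs_le_of_growth hσ hA hu x y
      have a2 := abs_le_of_growth_sub hσ hA hu x y
      have a3 := norm_secondDiff_le u x y
      simp only [Real.norm_eq_abs] at a3
      have a4 : A * (1 + ‖x‖) ^ σ * (1 + ‖y‖) ^ σ ≤ A * (1 + ‖x‖) ^ σ * (2 ^ σ * ‖y‖ ^ σ) := by
        gcongr
      calc _ ≤ 4 * (A * (1 + ‖x‖) ^ σ * (2 ^ σ * ‖y‖ ^ σ)) := by linarith
        _ = _ := by ring
    calc (‖y‖ ^ p)⁻¹ * |secondDiff u x y|
        ≤ (‖y‖ ^ p)⁻¹ * (4 * A * 2 ^ σ * (1 + ‖x‖) ^ σ * ‖y‖ ^ σ) := by gcongr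
      _ = 4 * A * 2 ^ σ * (1 + ‖x‖) ^ σ * ‖y‖ ^ (σ - p) := by
          rw [Real.rpow_sub hy']; field_simp
      _ ≤ _ := by gcongr; linarith

/-! ### Duality of the symmetrized integral with Schwartz functions. -/

lemma integrable_growth_mul_schwartz (hσ : 0 ≤ σ) (hA : 0 ≤ A) (huc : Continuous u)
    (hu : ∀ x, |u x| ≤ A * (1 + ‖x‖) ^ σ) (φ : 𝓢(EuclideanSpace ℝ (Fin n), ℝ))
    (a : EuclideanSpace ℝ (Fin n)) : Integrable fun x => u (x + a) * φ x := by
  obtain ⟨C, hC0, hC⟩ := exists_norm_le_rpow φ (σ + (n + 1))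
  refine Integrable.mono' ((integrable_rpow_one_add_norm (n := n) (r := n + 1)
    (by linarith)).const_mul (A * (1 + ‖a‖) ^ σ * C)) ?_ ?_
  · have := φ.continuous
    exact Continuous.aestronglyMeasurable (by fun_prop)
  · filter_upwards with x
    rw [norm_mul]
    calc ‖u (x + a)‖ * ‖φ x‖ ≤ (A * (1 + ‖x‖) ^ σ * (1 + ‖a‖) ^ σ) *
        (C * (1 + ‖x‖) ^ (-(σ + (n + 1)))) := by
          gcongr
          · exact abs_le_of_growth hσ hA hu x a
          · exact hC x
      _ = A * (1 + ‖a‖) ^ σ * C * ((1 + ‖x‖) ^ σ * (1 + ‖x‖) ^ (-(σ + ((n : ℝ) + 1)))) := by ring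
      _ = _ := by
          rw [← Real.rpow_add (by positivity)]; congr 2; ring

/-- Translating the variable by `±y` moves the shifts from `u` to `φ` and exchanges the two shifted
terms. -/
lemma integral_secondDiff_mul (hσ : 0 ≤ σ) (hA : 0 ≤ A) (huc : Continuous u)
    (hu : ∀ x, |u x| ≤ A * (1 + ‖x‖) ^ σ) (φ : 𝓢(EuclideanSpace ℝ (Fin n), ℝ))
    (y : EuclideanSpace ℝ (Fin n)) :
    ∫ x, secondDiff u x y * φ x = ∫ x, u x * secondDiff φ x y := by
  have i := integrable_growth_mul_schwartz hσ hA huc hu φ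
  have i0 : Integrable fun x => u x * φ x := by simpa using i 0
  have i1 : Integrable fun x => u x * φ (x + y) := by
    simpa using (i (-y)).comp_add_right y
  have i2 : Integrable fun x => u x * φ (x - y) := by
    simpa using (i y).comp_sub_right y
  have e1 : ∫ x, u (x + (-y)) * φ x = ∫ x, u x * φ (x + y) := by
    rw [← integral_add_right_eq_self (fun x => u (x + (-y)) * φ x) y]; simp
  have e2 : ∫ x, u (x + y) * φ x = ∫ x, u x * φ (x - y) := by
    rw [← integral_sub_right_eq_self (fun x => u (x + y) * φ x) y]; simp
  have l : ∀ x, secondDiff u x y * φ x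
      = 2 * (u x * φ x) - u (x + y) * φ x - u (x + (-y)) * φ x := by
    intro x; simp only [secondDiff, smul_eq_mul, ← sub_eq_add_neg]; ring
  have r : ∀ x, u x * secondDiff φ x y
      = 2 * (u x * φ x) - u x * φ (x + y) - u x * φ (x - y) := by
    intro x; simp only [secondDiff, smul_eq_mul]; ring
  simp only [l, r]
  have d1 := integral_sub ((i0.const_mul 2).sub (i y)) (i (-y))
  have d2 := integral_sub ((i0.const_mul 2).sub i1) i2
  simp only [Pi.sub_apply] at d1 d2
  rw [d1, d2, integral_sub (i0.const_mul 2) (i y), integral_sub (i0.const_mul 2) i1, e1, e2]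
  ring

variable [NeZero n] {b H : ℝ}

lemma integrable_symm_of_growth (hσ : 0 ≤ σ) (hσs : σ < 2 * s) (hb : 2 * s < b) (hA : 0 ≤ A)
    (hH : 0 ≤ H) (huc : Continuous u) (hu : ∀ x, |u x| ≤ A * (1 + ‖x‖) ^ σ)
    (hD : ∀ x y, |secondDiff u x y| ≤ H * ‖y‖ ^ b) (x : EuclideanSpace ℝ (Fin n)) :
    Integrable fun y => (‖y‖ ^ ((n : ℝ) + 2 * s))⁻¹ • secondDiff u x y := by
  obtain ⟨C, hC0, hC⟩ := exists_secondDiff_le_growth (p := (n : ℝ) + 2 * s) hσ hA hH hu hD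
  refine Integrable.mono' ((integrable_radialPow_euclidean (b := b - (n + 2 * s))
    (g := σ - (n + 2 * s)) (by linarith) (by linarith)).const_mul (C * (1 + ‖x‖) ^ σ))
    (aestronglyMeasurable_symm huc x) ?_
  filter_upwards with y
  rw [norm_smul, Real.norm_of_nonneg (by positivity)]
  exact hC x y

lemma continuous_symmIntegral_of_growth (hσ : 0 ≤ σ) (hσs : σ < 2 * s) (hb : 2 * s < b)
    (hA : 0 ≤ A) (hH : 0 ≤ H) (huc : Continuous u) (hu : ∀ x, |u x| ≤ A * (1 + ‖x‖) ^ σ)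
    (hD : ∀ x y, |secondDiff u x y| ≤ H * ‖y‖ ^ b) :
    Continuous (symmIntegral ((n : ℝ) + 2 * s) u) := by
  obtain ⟨C, hC0, hC⟩ := exists_secondDiff_le_growth (p := (n : ℝ) + 2 * s) hσ hA hH hu hD
  refine continuous_iff_continuousAt.2 fun x₀ => ?_
  refine continuousAt_of_dominated (bound := fun y => C * (2 + ‖x₀‖) ^ σ *
    radialPow (b - (n + 2 * s)) (σ - (n + 2 * s)) y)
    (Eventually.of_forall fun x => aestronglyMeasurable_symm huc x) ?_
    ((integrable_radialPow_euclidean (by linarith) (by linarith)).const_mul _) ?_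
  · filter_upwards [Metric.ball_mem_nhds x₀ one_pos] with x hx
    filter_upwards with y
    rw [norm_smul, Real.norm_of_nonneg (by positivity)]
    refine (hC x y).trans ?_
    have := radialPow_nonneg (b - (n + 2 * s)) (σ - (n + 2 * s)) y
    rw [Metric.mem_ball, dist_eq_norm] at hx
    have h1 : ‖x‖ ≤ ‖x - x₀‖ + ‖x₀‖ := by simpa using norm_add_le (x - x₀) x₀
    have h2 : 1 + ‖x‖ ≤ 2 + ‖x₀‖ := by linarith
    gcongr
  · filter_upwards with y
    refine Continuous.continuousAt ?_
    unfold secondDiff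
    fun_prop

/-- After integration in `y` the kernel decays like `(1 + ‖x‖) ^ (-(n + 2s))`; against the growth `σ
< 2s` of `u` there remains an exponent above `n`. -/
lemma integrable_prod_mul_symm_schwartz (hs0 : 0 < s) (hs1 : s < 1) (hσs : σ < 2 * s)
    (huc : Continuous u) (hu : ∀ x, |u x| ≤ A * (1 + ‖x‖) ^ σ)
    (φ : 𝓢(EuclideanSpace ℝ (Fin n), ℝ)) :
    Integrable (fun z : EuclideanSpace ℝ (Fin n) × EuclideanSpace ℝ (Fin n) =>
      u z.1 * ((‖z.2‖ ^ ((n : ℝ) + 2 * s))⁻¹ • secondDiff φ z.1 z.2)) := by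
  have hp1 : (n : ℝ) < n + 2 * s := by linarith
  have hp2 : (n : ℝ) + 2 * s < n + 2 := by linarith
  obtain ⟨C, hC0, hC⟩ := exists_weight_mul_integral_le hp1 hp2 φ
  have hm : AEStronglyMeasurable (fun z : EuclideanSpace ℝ (Fin n) × EuclideanSpace ℝ (Fin n) =>
      u z.1 * ((‖z.2‖ ^ ((n : ℝ) + 2 * s))⁻¹ • secondDiff φ z.1 z.2)) :=
    ((huc.comp continuous_fst).aestronglyMeasurable).mul
      (aestronglyMeasurable_symm_prod φ.continuous)
  refine (integrable_prod_iff hm).2 ⟨?_, ?_⟩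
  · filter_upwards with x
    exact (integrable_symm_schwartz hp1 hp2 φ x).const_mul _
  · refine Integrable.mono' ((integrable_rpow_one_add_norm (n := n) (r := n + 2 * s - σ)
      (by linarith)).const_mul (A * C)) hm.norm.integral_prod_right' ?_
    filter_upwards with x
    simp only [norm_mul (u x)]
    rw [integral_const_mul, norm_mul, norm_norm,
      Real.norm_of_nonneg (integral_nonneg fun _ => norm_nonneg _)]
    have hx : 0 < 1 + ‖x‖ := by positivity
    have h1 : ∫ y, ‖(‖y‖ ^ ((n : ℝ) + 2 * s))⁻¹ • secondDiff φ x y‖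
        ≤ C * ((1 + ‖x‖) ^ ((n : ℝ) + 2 * s))⁻¹ := by
      rw [← div_eq_mul_inv, le_div_iff₀ (by positivity), mul_comm]
      exact hC x
    calc _ ≤ (A * (1 + ‖x‖) ^ σ) * (C * ((1 + ‖x‖) ^ ((n : ℝ) + 2 * s))⁻¹) :=
          mul_le_mul (hu x) h1 (integral_nonneg fun _ => norm_nonneg _)
            ((abs_nonneg _).trans (hu x))
      _ = A * C * ((1 + ‖x‖) ^ σ * ((1 + ‖x‖) ^ ((n : ℝ) + 2 * s))⁻¹) := by ring
      _ = _ := by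
          rw [← Real.rpow_neg hx.le, ← Real.rpow_add hx]; congr 2; ring

lemma integrable_mul_symmIntegral (hs0 : 0 < s) (hs1 : s < 1) (hσs : σ < 2 * s)
    (huc : Continuous u) (hu : ∀ x, |u x| ≤ A * (1 + ‖x‖) ^ σ)
    (φ : 𝓢(EuclideanSpace ℝ (Fin n), ℝ)) :
    Integrable fun x => u x * symmIntegral ((n : ℝ) + 2 * s) φ x := by
  have := (integrable_prod_mul_symm_schwartz hs0 hs1 hσs huc hu φ).integral_prod_left
  simp only [integral_const_mul] at this
  exact this

/-- The symmetrized singular integral is a symmetric operator. -/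
lemma integral_symmIntegral_mul (hs0 : 0 < s) (hs1 : s < 1) (hσ : 0 ≤ σ) (hσs : σ < 2 * s)
    (hb : 2 * s < b) (hA : 0 ≤ A) (hH : 0 ≤ H) (huc : Continuous u)
    (hu : ∀ x, |u x| ≤ A * (1 + ‖x‖) ^ σ) (hD : ∀ x y, |secondDiff u x y| ≤ H * ‖y‖ ^ b)
    (φ : 𝓢(EuclideanSpace ℝ (Fin n), ℝ)) :
    ∫ x, symmIntegral ((n : ℝ) + 2 * s) u x * φ x
      = ∫ x, u x * symmIntegral ((n : ℝ) + 2 * s) φ x := by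
  have hn : (0 : ℝ) ≤ n := Nat.cast_nonneg n
  have i2 := integrable_prod_mul_symm_schwartz hs0 hs1 hσs huc hu φ
  -- Here the second difference of `u` tames the singularity at `y = 0`, while `φ` supplies the
  -- decay in `x`. The majorant is a product of a function of `x` and a function of `y`.
  have i1 : Integrable (fun z : EuclideanSpace ℝ (Fin n) × EuclideanSpace ℝ (Fin n) =>
      ((‖z.2‖ ^ ((n : ℝ) + 2 * s))⁻¹ • secondDiff u z.1 z.2) * φ z.1) := by
    obtain ⟨C, hC0, hC⟩ := exists_secondDiff_le_growth (p := (n : ℝ) + 2 * s) hσ hA hH hu hD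
    obtain ⟨B, hB0, hB⟩ := exists_norm_le_rpow φ (σ + (n + 1))
    refine Integrable.mono' (((integrable_rpow_one_add_norm (n := n) (r := n + 1)
      (by linarith)).const_mul (C * B)).mul_prod (integrable_radialPow_euclidean
      (n := n) (b := b - (n + 2 * s)) (g := σ - (n + 2 * s)) (by linarith) (by linarith))) ?_ ?_
    · exact (aestronglyMeasurable_symm_prod huc).mul
        (φ.continuous.comp continuous_fst).aestronglyMeasurable
    · filter_upwards with z
      rw [norm_mul, norm_smul, Real.norm_of_nonneg (by positivity)]
      have := radialPow_nonneg (b - (n + 2 * s)) (σ - (n + 2 * s)) z.2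
      calc _ ≤ (C * (1 + ‖z.1‖) ^ σ * radialPow (b - (n + 2 * s)) (σ - (n + 2 * s)) z.2) *
            (B * (1 + ‖z.1‖) ^ (-(σ + (n + 1)))) := by
            exact mul_le_mul (hC z.1 z.2) (hB z.1) (norm_nonneg _) (by positivity)
        _ = C * B * ((1 + ‖z.1‖) ^ σ * (1 + ‖z.1‖) ^ (-(σ + ((n : ℝ) + 1)))) *
            radialPow (b - (n + 2 * s)) (σ - (n + 2 * s)) z.2 := by ring
        _ = _ := by
            rw [← Real.rpow_add (by positivity)]; congr 3; ring
  calc ∫ x, symmIntegral ((n : ℝ) + 2 * s) u x * φ x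
      = ∫ x, ∫ y, ((‖y‖ ^ ((n : ℝ) + 2 * s))⁻¹ • secondDiff u x y) * φ x := by
        simp only [integral_mul_const]; rfl
    _ = ∫ y, ∫ x, ((‖y‖ ^ ((n : ℝ) + 2 * s))⁻¹ • secondDiff u x y) * φ x :=
        integral_integral_swap i1
    _ = ∫ y, ∫ x, u x * ((‖y‖ ^ ((n : ℝ) + 2 * s))⁻¹ • secondDiff φ x y) := by
        congr 1; ext y
        simp only [smul_eq_mul, mul_assoc, mul_left_comm (u _)]
        rw [integral_const_mul, integral_const_mul, integral_secondDiff_mul hσ hA huc hu]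
    _ = ∫ x, ∫ y, u x * ((‖y‖ ^ ((n : ℝ) + 2 * s))⁻¹ • secondDiff φ x y) :=
        (integral_integral_swap i2).symm
    _ = _ := by simp only [integral_const_mul]; rfl

/-- Symmetry tested against the constant `1`, whose second differences vanish. It is the
cancellation that later removes the compensator. -/
lemma integral_symmIntegral_schwartz (hs0 : 0 < s) (hs1 : s < 1)
    (φ : 𝓢(EuclideanSpace ℝ (Fin n), ℝ)) :
    ∫ x, symmIntegral ((n : ℝ) + 2 * s) φ x = 0 := by
  have hD : ∀ x y, secondDiff (fun _ : EuclideanSpace ℝ (Fin n) => (1 : ℝ)) x y = 0 := by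
    intro x y; simp only [secondDiff, smul_eq_mul]; norm_num
  have := integral_symmIntegral_mul (u := fun _ => (1 : ℝ)) (σ := 0) (A := 1) (H := 0)
    (b := 2 * s + 1) hs0 hs1 le_rfl (by linarith) (by linarith) zero_le_one le_rfl
    continuous_const (by simp) (by simp [hD]) φ
  simp only [one_mul] at this
  rw [← this]
  simp [symmIntegral, hD]

lemma hasFracLaplacianAt_schwartz (hs0 : 0 < s) (hs1 : s < 1)
    (φ : 𝓢(EuclideanSpace ℝ (Fin n), ℝ)) (x : EuclideanSpace ℝ (Fin n)) :
    HasFracLaplacianAt s φ x (normConst n s / 2 * symmIntegral ((n : ℝ) + 2 * s) φ x) := by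
  obtain ⟨A, hA0, hA⟩ := exists_norm_le_rpow φ 0
  exact hasFracLaplacianAt_of_integrable (σ := 0) le_rfl (by linarith) hA0 φ.continuous
    (by simpa using hA) x (integrable_symm_schwartz (by linarith) (by linarith) φ x)

end

open scoped FourierTransform RealInnerProductSpace

/-! ### The Fourier multiplier of the fractional Laplacian -/

/-- The integral `∫ (1 - cos ⟪ξ, y⟫) / ‖y‖ ^ p dy`. -/
def cosIntegral {n : ℕ} (p : ℝ) (ξ : EuclideanSpace ℝ (Fin n)) : ℝ :=
  ∫ y : EuclideanSpace ℝ (Fin n), (1 - Real.cos ⟪ξ, y⟫) / ‖y‖ ^ p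

section Multiplier

variable {n : ℕ}

lemma cosIntegral_map (p : ℝ) (R : EuclideanSpace ℝ (Fin n) ≃ₗᵢ[ℝ] EuclideanSpace ℝ (Fin n))
    (ξ : EuclideanSpace ℝ (Fin n)) : cosIntegral p (R ξ) = cosIntegral p ξ := by
  unfold cosIntegral
  have := (R.measurePreserving).integral_comp R.toHomeomorph.measurableEmbedding
    (fun y => (1 - Real.cos ⟪R ξ, y⟫) / ‖y‖ ^ p)
  rw [← this]
  simp

/-- Two vectors of equal norm are exchanged by a reflection, and the kernel is invariant under
isometries. -/
lemma cosIntegral_eq_of_norm_eq (p : ℝ) {v w : EuclideanSpace ℝ (Fin n)} (h : ‖v‖ = ‖w‖) :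
    cosIntegral p v = cosIntegral p w := by
  rw [← Submodule.reflection_sub h, cosIntegral_map]

/-- Substitution of `r • y` for `y`: the Jacobian `r ^ n` cancels against part of the kernel and
leaves `r ^ (2 * s)`. -/
lemma cosIntegral_smul (s : ℝ) {r : ℝ} (hr : 0 < r) (ξ : EuclideanSpace ℝ (Fin n)) :
    cosIntegral ((n : ℝ) + 2 * s) (r • ξ) = r ^ (2 * s) * cosIntegral ((n : ℝ) + 2 * s) ξ := by
  unfold cosIntegral
  have h := Measure.integral_comp_smul volume
    (fun y : EuclideanSpace ℝ (Fin n) => (1 - Real.cos ⟪ξ, y⟫) / ‖y‖ ^ ((n : ℝ) + 2 * s)) r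
  rw [finrank_euclideanSpace_fin, abs_of_pos (by positivity), smul_eq_mul,
    ← div_eq_inv_mul, eq_div_iff (by positivity)] at h
  rw [← h, ← integral_mul_const, ← integral_const_mul]
  congr 1
  ext y
  rw [norm_smul, Real.norm_of_nonneg hr.le, Real.mul_rpow hr.le (norm_nonneg _),
    Real.rpow_add hr, Real.rpow_natCast, real_inner_smul_left, real_inner_smul_right]
  have : r ^ (2 * s) ≠ 0 := by positivity
  have : r ^ n ≠ 0 := by positivity
  field_simp

variable [NeZero n]

lemma integrable_cos {p : ℝ} (hp1 : (n : ℝ) < p) (hp2 : p < n + 2)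
    (ξ : EuclideanSpace ℝ (Fin n)) :
    Integrable fun y : EuclideanSpace ℝ (Fin n) => (1 - Real.cos ⟪ξ, y⟫) / ‖y‖ ^ p := by
  refine Integrable.mono' ((integrable_radialPow_euclidean (n := n) (b := 2 - p) (g := -p)
    (by linarith) (by linarith)).const_mul (2 + ‖ξ‖ ^ 2)) ?_ ?_
  · refine Measurable.aestronglyMeasurable ?_
    exact Measurable.div (Continuous.measurable (by fun_prop)) (measurable_norm.pow_const _)
  · filter_upwards with y
    have h0 : 0 ≤ 1 - Real.cos ⟪ξ, y⟫ := by linarith [Real.cos_le_one ⟪ξ, y⟫]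
    rw [Real.norm_of_nonneg (by positivity), radialPow]
    split_ifs with hy
    · rcases eq_or_ne y 0 with rfl | hy0
      · simp; positivity
      have hy' : 0 < ‖y‖ := norm_pos_iff.2 hy0
      have e : ‖y‖ ^ (2 : ℝ) = ‖y‖ ^ 2 := by norm_cast
      rw [Real.rpow_sub hy', e, mul_div_assoc']
      gcongr
      have h1 := Real.one_sub_sq_div_two_le_cos (x := ⟪ξ, y⟫)
      have h2 : ⟪ξ, y⟫ ^ 2 ≤ ‖ξ‖ ^ 2 * ‖y‖ ^ 2 := by
        rw [← mul_pow]
        exact sq_le_sq' (by linarith [abs_le.1 (abs_real_inner_le_norm ξ y)])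
          (real_inner_le_norm ξ y)
      nlinarith [sq_nonneg ‖y‖, sq_nonneg ‖ξ‖]
    · rw [Real.rpow_neg (norm_nonneg _), div_eq_mul_inv]
      gcongr
      nlinarith [Real.neg_one_le_cos ⟪ξ, y⟫, sq_nonneg ‖ξ‖]

lemma normConst_eq (s : ℝ) : normConst n s =
    (cosIntegral ((n : ℝ) + 2 * s) (EuclideanSpace.single (0 : Fin n) (1 : ℝ)))⁻¹ := by
  simp [normConst, cosIntegral, EuclideanSpace.inner_single_left]

/-- The integrand is nonnegative and does not vanish on the ball of radius `1/2` about the first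
basis vector, where `y 0` lies strictly between `0` and `2π`. -/
lemma cosIntegral_single_pos {s : ℝ} (hs0 : 0 < s) (hs1 : s < 1) :
    0 < cosIntegral ((n : ℝ) + 2 * s) (EuclideanSpace.single (0 : Fin n) (1 : ℝ)) := by
  refine (integral_pos_iff_support_of_nonneg (fun y => ?_)
    (integrable_cos (by linarith) (by linarith) _)).2 ?_
  · have : 0 ≤ 1 - Real.cos ⟪EuclideanSpace.single (0 : Fin n) (1 : ℝ), y⟫ := by
      linarith [Real.cos_le_one ⟪EuclideanSpace.single (0 : Fin n) (1 : ℝ), y⟫]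
    simp only [Pi.zero_apply]
    positivity
  · refine lt_of_lt_of_le (Metric.measure_ball_pos volume
      (EuclideanSpace.single (0 : Fin n) (1 : ℝ)) (r := 1 / 2) (by norm_num)) (measure_mono ?_)
    intro y hy
    rw [Metric.mem_ball, dist_eq_norm] at hy
    have h1 := (PiLp.norm_apply_le (y - EuclideanSpace.single (0 : Fin n) (1 : ℝ)) 0).trans_lt hy
    simp only [PiLp.sub_apply, PiLp.single_apply, if_true, Real.norm_eq_abs] at h1
    rw [abs_lt] at h1
    have hy0 : y ≠ 0 := by
      rintro rfl
      simp at h1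
      linarith
    have hy' : 0 < ‖y‖ := norm_pos_iff.2 hy0
    rw [Function.mem_support]
    refine div_ne_zero ?_ (by positivity)
    rw [EuclideanSpace.inner_single_left]
    simp only [map_one, one_mul]
    intro h
    have hcos : Real.cos (y 0) = 1 := by linarith
    rw [Real.cos_eq_one_iff_of_lt_of_lt (by linarith [Real.pi_gt_three])
      (by linarith [Real.pi_gt_three])] at hcos
    linarith

lemma normConst_pos {s : ℝ} (hs0 : 0 < s) (hs1 : s < 1) : 0 < normConst n s := by
  rw [normConst_eq]; exact inv_pos.2 (cosIntegral_single_pos hs0 hs1)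

/-- Rotation invariance and homogeneity reduce the integral at `ξ` to the one at the first basis
vector, whose inverse is by definition `normConst`. -/
lemma normConst_mul_cosIntegral {s : ℝ} (hs0 : 0 < s) (hs1 : s < 1)
    (ξ : EuclideanSpace ℝ (Fin n)) :
    normConst n s * cosIntegral ((n : ℝ) + 2 * s) ξ = ‖ξ‖ ^ (2 * s) := by
  rcases eq_or_ne ξ 0 with rfl | hξ
  · rw [norm_zero, Real.zero_rpow (by positivity)]
    simp [cosIntegral]
  have hξ' : 0 < ‖ξ‖ := norm_pos_iff.2 hξ
  have e : cosIntegral ((n : ℝ) + 2 * s) ξ = cosIntegral ((n : ℝ) + 2 * s)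
      (‖ξ‖ • EuclideanSpace.single (0 : Fin n) (1 : ℝ)) :=
    cosIntegral_eq_of_norm_eq _ (by rw [norm_smul]; simp)
  have := (cosIntegral_single_pos (n := n) hs0 hs1).ne'
  rw [e, cosIntegral_smul s hξ', normConst_eq]
  field_simp

end Multiplier

/-! ### The Fourier representation of the fractional Laplacian of a Schwartz function -/

section Fourier

variable {n : ℕ}

/-- The Fourier transform of a real valued Schwartz function. -/
def fourierReal (φ : 𝓢(EuclideanSpace ℝ (Fin n), ℝ)) : 𝓢(EuclideanSpace ℝ (Fin n), ℂ) :=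
  𝓕 (SchwartzMap.postcompCLM Complex.ofRealCLM φ)

/-- The character `exp (2 π i ⟪ξ, x⟫)`. -/
def expInner (ξ x : EuclideanSpace ℝ (Fin n)) : ℂ :=
  Complex.exp ((2 * Real.pi * ⟪ξ, x⟫ : ℝ) * Complex.I)

lemma norm_expInner (ξ x : EuclideanSpace ℝ (Fin n)) : ‖expInner ξ x‖ = 1 :=
  Complex.norm_exp_ofReal_mul_I _

lemma expInner_add (ξ x y : EuclideanSpace ℝ (Fin n)) :
    expInner ξ (x + y) = expInner ξ x * expInner ξ y := by
  rw [expInner, expInner, expInner, ← Complex.exp_add, inner_add_right]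
  congr 1; push_cast; ring

lemma expInner_sub (ξ x y : EuclideanSpace ℝ (Fin n)) :
    expInner ξ (x - y) = expInner ξ x * expInner ξ (-y) := by
  rw [sub_eq_add_neg, expInner_add]

lemma continuous_expInner : Continuous
    (fun z : EuclideanSpace ℝ (Fin n) × EuclideanSpace ℝ (Fin n) => expInner z.1 z.2) := by
  unfold expInner; fun_prop

lemma expInner_add_expInner_neg (ξ y : EuclideanSpace ℝ (Fin n)) :
    expInner ξ y + expInner ξ (-y) = ((2 * Real.cos ⟪(2 * Real.pi) • ξ, y⟫ : ℝ) : ℂ) := by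
  have h : ∀ t : ℝ, Complex.exp ((t : ℝ) * Complex.I) + Complex.exp ((-t : ℝ) * Complex.I) =
      ((2 * Real.cos t : ℝ) : ℂ) := by
    intro t
    push_cast
    rw [Complex.two_cos]
  rw [expInner, expInner, inner_neg_right, real_inner_smul_left, mul_neg, h]

lemma continuous_fourierReal_mul_expInner (φ : 𝓢(EuclideanSpace ℝ (Fin n), ℝ))
    (x : EuclideanSpace ℝ (Fin n)) : Continuous fun ξ => fourierReal φ ξ * expInner ξ x := by
  have h1 := (fourierReal φ).continuous
  have h2 : Continuous fun ξ : EuclideanSpace ℝ (Fin n) => expInner ξ x :=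
    continuous_expInner.comp (continuous_id.prodMk continuous_const)
  exact Continuous.mul h1 h2

lemma integrable_fourierReal_mul_expInner (φ : 𝓢(EuclideanSpace ℝ (Fin n), ℝ))
    (x : EuclideanSpace ℝ (Fin n)) : Integrable fun ξ => fourierReal φ ξ * expInner ξ x := by
  refine (fourierReal φ).integrable.norm.mono' ?_ ?_
  · exact (continuous_fourierReal_mul_expInner φ x).aestronglyMeasurable
  · filter_upwards with ξ
    rw [norm_mul, norm_expInner, mul_one]

lemma integral_fourierReal_mul_expInner (φ : 𝓢(EuclideanSpace ℝ (Fin n), ℝ))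
    (x : EuclideanSpace ℝ (Fin n)) : ∫ ξ, fourierReal φ ξ * expInner ξ x = (φ x : ℂ) := by
  have h : 𝓕⁻ (fourierReal φ) = SchwartzMap.postcompCLM Complex.ofRealCLM φ :=
    FourierTransform.fourierInv_fourier_eq _
  have h2 : 𝓕⁻ (fourierReal φ : EuclideanSpace ℝ (Fin n) → ℂ) x = (φ x : ℂ) := by
    rw [← SchwartzMap.fourierInv_coe, h, SchwartzMap.postcompCLM_apply]
    rfl
  rw [← h2, Real.fourierInv_eq']
  congr 1
  ext ξ
  rw [smul_eq_mul, mul_comm]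
  rfl

/-- Fourier inversion at `x`, `x + y` and `x - y`; the characters of `y` and `-y` add up to a
cosine. Integrated against the kernel in `y`, the cosine factor produces the multiplier. -/
lemma ofReal_secondDiff_eq (φ : 𝓢(EuclideanSpace ℝ (Fin n), ℝ))
    (x y : EuclideanSpace ℝ (Fin n)) :
    ((secondDiff φ x y : ℝ) : ℂ) = ∫ ξ, fourierReal φ ξ * expInner ξ x *
      ((2 * (1 - Real.cos ⟪(2 * Real.pi) • ξ, y⟫) : ℝ) : ℂ) := by
  have i := integrable_fourierReal_mul_expInner φ
  have d := integral_sub (((i x).const_mul 2).sub (i (x + y))) (i (x - y))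
  simp only [Pi.sub_apply] at d
  rw [integral_sub ((i x).const_mul 2) (i (x + y)), integral_const_mul,
    integral_fourierReal_mul_expInner, integral_fourierReal_mul_expInner,
    integral_fourierReal_mul_expInner] at d
  simp only [secondDiff, smul_eq_mul]
  push_cast
  rw [← d]
  congr 1
  ext ξ
  have := expInner_add_expInner_neg ξ y
  push_cast at this
  rw [expInner_add, expInner_sub]
  linear_combination (-(fourierReal φ ξ * expInner ξ x)) * this

lemma integrable_fourierReal_mul_rpow {s : ℝ} (hs0 : 0 < s)
    (φ : 𝓢(EuclideanSpace ℝ (Fin n), ℝ)) :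
    Integrable fun ξ => ‖fourierReal φ ξ‖ * ‖(2 * Real.pi) • ξ‖ ^ (2 * s) := by
  obtain ⟨C, hC0, hC⟩ := exists_norm_le_rpow (fourierReal φ) (2 * s + (n + 1))
  refine Integrable.mono' ((integrable_rpow_one_add_norm (n := n) (r := n + 1)
    (by linarith)).const_mul (C * (2 * Real.pi) ^ (2 * s))) ?_ ?_
  · refine Continuous.aestronglyMeasurable ?_
    have h1 := (fourierReal φ).continuous
    have h2 : Continuous fun ξ : EuclideanSpace ℝ (Fin n) =>
        ‖(2 * Real.pi) • ξ‖ ^ (2 * s) :=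
      Continuous.rpow_const (by fun_prop) fun _ => Or.inr (by positivity)
    fun_prop
  · filter_upwards with ξ
    rw [Real.norm_of_nonneg (by positivity), norm_smul,
      Real.norm_of_nonneg (by positivity : 0 ≤ 2 * Real.pi),
      Real.mul_rpow (by positivity) (norm_nonneg _)]
    calc _ ≤ (C * (1 + ‖ξ‖) ^ (-(2 * s + ((n : ℝ) + 1)))) *
          ((2 * Real.pi) ^ (2 * s) * (1 + ‖ξ‖) ^ (2 * s)) := by
          gcongr
          · exact hC ξ
          · linarith
      _ = C * (2 * Real.pi) ^ (2 * s) *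
          ((1 + ‖ξ‖) ^ (-(2 * s + ((n : ℝ) + 1))) * (1 + ‖ξ‖) ^ (2 * s)) := by ring
      _ = _ := by
          rw [← Real.rpow_add (by positivity)]; congr 2; ring

variable [NeZero n]

/-- The fractional Laplacian of a Schwartz function, as an inverse Fourier transform. -/
lemma ofReal_symmIntegral_eq {s : ℝ} (hs0 : 0 < s) (hs1 : s < 1)
    (φ : 𝓢(EuclideanSpace ℝ (Fin n), ℝ)) (x : EuclideanSpace ℝ (Fin n)) :
    ((normConst n s / 2 * symmIntegral ((n : ℝ) + 2 * s) φ x : ℝ) : ℂ) =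
      ∫ ξ, fourierReal φ ξ * expInner ξ x * ((‖(2 * Real.pi) • ξ‖ ^ (2 * s) : ℝ) : ℂ) := by
  have hN := (normConst_pos (n := n) hs0 hs1).ne'
  have hp1 : (n : ℝ) < n + 2 * s := by linarith
  have hp2 : (n : ℝ) + 2 * s < n + 2 := by linarith
  set p : ℝ := (n : ℝ) + 2 * s with hp
  set G : EuclideanSpace ℝ (Fin n) → EuclideanSpace ℝ (Fin n) → ℂ := fun ξ y =>
    fourierReal φ ξ * expInner ξ x *
      ((2 * ((1 - Real.cos ⟪(2 * Real.pi) • ξ, y⟫) / ‖y‖ ^ p) : ℝ) : ℂ) with hG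
  have hnn : ∀ ξ y : EuclideanSpace ℝ (Fin n),
      0 ≤ 2 * ((1 - Real.cos ⟪(2 * Real.pi) • ξ, y⟫) / ‖y‖ ^ p) := by
    intro ξ y
    have : 0 ≤ 1 - Real.cos ⟪(2 * Real.pi) • ξ, y⟫ := by
      linarith [Real.cos_le_one ⟪(2 * Real.pi) • ξ, y⟫]
    positivity
  have hcos : ∀ ξ : EuclideanSpace ℝ (Fin n),
      ∫ y : EuclideanSpace ℝ (Fin n), 2 * ((1 - Real.cos ⟪(2 * Real.pi) • ξ, y⟫) / ‖y‖ ^ p)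
        = 2 / normConst n s * ‖(2 * Real.pi) • ξ‖ ^ (2 * s) := by
    intro ξ
    rw [integral_const_mul, ← normConst_mul_cosIntegral (n := n) hs0 hs1]
    rw [cosIntegral, ← hp]
    field_simp
  have hcont := continuous_fourierReal_mul_expInner φ x
  have hm : AEStronglyMeasurable (Function.uncurry G) (volume.prod volume) := by
    refine AEStronglyMeasurable.mul (hcont.comp continuous_fst).aestronglyMeasurable ?_
    refine Measurable.aestronglyMeasurable ?_
    refine Complex.measurable_ofReal.comp (Measurable.const_mul (Measurable.div ?_ ?_) 2)
    · exact Continuous.measurable (by fun_prop)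
    · exact (measurable_snd.norm.pow_const _)
  have hnorm : ∀ ξ y, ‖G ξ y‖ = ‖fourierReal φ ξ‖ *
      (2 * ((1 - Real.cos ⟪(2 * Real.pi) • ξ, y⟫) / ‖y‖ ^ p)) := by
    intro ξ y
    rw [hG]
    simp only
    rw [norm_mul, norm_mul, norm_expInner, mul_one, Complex.norm_real,
      Real.norm_of_nonneg (hnn ξ y)]
  -- The cosine factor is nonnegative, so its absolute integral in `y` is the multiplier itself, and
  -- integrability reduces to that of `φ̂(ξ) |2πξ| ^ (2s)`.
  have hi : Integrable (Function.uncurry G) (volume.prod volume) := by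
    refine (integrable_prod_iff hm).2 ⟨?_, ?_⟩
    · filter_upwards with ξ
      exact (((integrable_cos hp1 hp2 ((2 * Real.pi) • ξ)).const_mul 2).ofReal
        (𝕜 := ℂ)).const_mul (fourierReal φ ξ * expInner ξ x)
    · simp only [Function.uncurry_apply_pair, hnorm, integral_const_mul]
      simp only [← integral_const_mul (2 : ℝ), hcos]
      convert (integrable_fourierReal_mul_rpow hs0 φ).const_mul (2 / normConst n s) using 2
      ring
  have hswap := integral_integral_swap hi
  have e1 : ∫ ξ, ∫ y, G ξ y = ∫ ξ, fourierReal φ ξ * expInner ξ x *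
      ((2 / normConst n s * ‖(2 * Real.pi) • ξ‖ ^ (2 * s) : ℝ) : ℂ) := by
    congr 1; ext ξ
    rw [← hcos ξ, hG]
    simp only
    rw [integral_const_mul, integral_complex_ofReal]
  have e2 : ∫ y, ∫ ξ, G ξ y = ((symmIntegral p φ x : ℝ) : ℂ) := by
    rw [symmIntegral, ← integral_complex_ofReal]
    congr 1; ext y
    rw [smul_eq_mul, Complex.ofReal_mul, ofReal_secondDiff_eq, ← integral_const_mul]
    congr 1; ext ξ
    rw [hG]
    push_cast
    ring
  rw [Complex.ofReal_mul, ← e2, ← hswap, e1, ← integral_const_mul]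
  congr 1; ext ξ
  have hNc : ((normConst n s : ℝ) : ℂ) ≠ 0 := Complex.ofReal_ne_zero.2 hN
  push_cast
  field_simp

attribute [irreducible] fourierReal expInner

end Fourier

/-! ### Subordination integrals -/

section Subordination

lemma integrableOn_rpow_mul_exp_neg {q r : ℝ} (hq : -1 < q) (hr : 0 < r) :
    IntegrableOn (fun t : ℝ => t ^ q * Real.exp (-(r * t))) (Set.Ioi 0) := by
  have := integrableOn_rpow_mul_exp_neg_mul_rpow hq one_pos hr
  simpa [neg_mul] using this

lemma integral_rpow_mul_exp_neg {q r : ℝ} (hq : -1 < q) (hr : 0 < r) :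
    ∫ t in Set.Ioi (0 : ℝ), t ^ q * Real.exp (-(r * t)) = Real.Gamma (q + 1) * r ^ (-q - 1) := by
  have := Real.integral_rpow_mul_exp_neg_mul_Ioi (a := q + 1) (by linarith) hr
  rw [add_sub_cancel_right] at this
  rw [this, one_div, Real.inv_rpow hr.le, ← Real.rpow_neg hr.le, mul_comm]
  congr 2; ring

/-- A Frullani type integral. -/
lemma integral_rpow_mul_exp_sub_exp {q a b : ℝ} (hq : -1 < q) (ha : 0 ≤ a) (hab : a ≤ b)
    (hi : IntervalIntegrable (fun ρ : ℝ => ρ ^ (-q - 1)) volume a b) :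
    IntegrableOn (fun t : ℝ => t ^ (q - 1) * (Real.exp (-(a * t)) - Real.exp (-(b * t))))
      (Set.Ioi 0) ∧
    ∫ t in Set.Ioi (0 : ℝ), t ^ (q - 1) * (Real.exp (-(a * t)) - Real.exp (-(b * t)))
      = Real.Gamma (q + 1) * ∫ ρ in a..b, ρ ^ (-q - 1) := by
  set G : ℝ → ℝ → ℝ := fun t ρ => t ^ q * Real.exp (-(ρ * t)) with hG
  have hm : AEStronglyMeasurable (Function.uncurry G)
      ((volume.restrict (Set.Ioi 0)).prod (volume.restrict (Set.Ioc a b))) := by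
    refine Measurable.aestronglyMeasurable ?_
    exact (measurable_fst.pow_const _).mul (Continuous.measurable (by fun_prop))
  have hmem : ∀ᵐ ρ ∂(volume.restrict (Set.Ioc a b)), 0 < ρ := by
    filter_upwards [ae_restrict_mem measurableSet_Ioc] with ρ hρ
    exact lt_of_le_of_lt ha hρ.1
  have hint : Integrable (Function.uncurry G)
      ((volume.restrict (Set.Ioi 0)).prod (volume.restrict (Set.Ioc a b))) := by
    refine (integrable_prod_iff' hm).2 ⟨?_, ?_⟩
    · filter_upwards [hmem] with ρ hρ
      exact integrableOn_rpow_mul_exp_neg hq hρ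
    · have h1 : Integrable (fun ρ : ℝ => Real.Gamma (q + 1) * ρ ^ (-q - 1))
          (volume.restrict (Set.Ioc a b)) :=
        ((intervalIntegrable_iff_integrableOn_Ioc_of_le hab).1 hi).const_mul _
      refine h1.congr ?_
      filter_upwards [hmem] with ρ hρ
      rw [← integral_rpow_mul_exp_neg hq hρ]
      refine setIntegral_congr_fun measurableSet_Ioi fun t ht => ?_
      have ht' : (0 : ℝ) < t := ht
      simp only [Function.uncurry_apply_pair, hG]
      rw [Real.norm_of_nonneg (by positivity)]
  -- The difference of exponentials is `t` times the integral of `exp(-ρt)` over `ρ` in `[a, b]`;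
  -- exchanging the integrals leaves a Gamma integral in `t`.
  have hinner : ∀ t : ℝ, 0 < t → ∫ ρ in Set.Ioc a b, G t ρ =
      t ^ (q - 1) * (Real.exp (-(a * t)) - Real.exp (-(b * t))) := by
    intro t ht
    rw [← intervalIntegral.integral_of_le hab]
    have hd : ∀ ρ ∈ Set.uIcc a b, HasDerivAt
        (fun ρ : ℝ => -(t ^ (q - 1) * Real.exp (-(ρ * t)))) (G t ρ) ρ := by
      intro ρ _
      have h1 : HasDerivAt (fun ρ : ℝ => -(ρ * t)) (-t) ρ := by
        simpa using! ((hasDerivAt_id ρ).mul_const t).neg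
      have h2 := (h1.exp.const_mul (t ^ (q - 1))).neg
      convert! h2 using 1
      simp only [hG]
      rw [Real.rpow_sub_one ht.ne']
      field_simp
    rw [intervalIntegral.integral_eq_sub_of_hasDerivAt hd
      (Continuous.intervalIntegrable (by simp only [hG]; fun_prop) _ _)]
    ring
  constructor
  · refine (hint.integral_prod_left).congr ?_
    filter_upwards [ae_restrict_mem measurableSet_Ioi] with t ht
    exact hinner t ht
  · have h := integral_integral_swap hint
    have e1 : ∫ t in Set.Ioi (0 : ℝ), ∫ ρ in Set.Ioc a b, G t ρ =
        ∫ t in Set.Ioi (0 : ℝ), t ^ (q - 1) * (Real.exp (-(a * t)) - Real.exp (-(b * t))) :=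
      setIntegral_congr_fun measurableSet_Ioi fun t ht => hinner t ht
    have e2 : ∫ ρ in Set.Ioc a b, ∫ t in Set.Ioi (0 : ℝ), G t ρ =
        ∫ ρ in Set.Ioc a b, Real.Gamma (q + 1) * ρ ^ (-q - 1) := by
      refine integral_congr_ae ?_
      filter_upwards [hmem] with ρ hρ
      exact integral_rpow_mul_exp_neg hq hρ
    rw [← e1, h, e2, integral_const_mul, intervalIntegral.integral_of_le hab]

/-- The compensator that makes `∫ τ ^ (q-1) (exp (-r τ) - c(τ)) dτ` converge. -/
def compensator (q t : ℝ) : ℝ := if 0 < q then 0 else if q = 0 then Real.exp (-t) else 1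

/-- The value of `∫ τ ^ (q-1) (exp (-r τ) - c(τ)) dτ`. -/
def gaussMoment (q r : ℝ) : ℝ := if q = 0 then -Real.log r else Real.Gamma q * r ^ (-q)

lemma measurable_compensator (q : ℝ) : Measurable (compensator q) := by
  unfold compensator
  split_ifs <;> fun_prop

/-- The integrand of the subordination formula. -/
def subordIntegrand (q r t : ℝ) : ℝ := t ^ (q - 1) * (Real.exp (-(r * t)) - compensator q t)

/-- For `q > 0` this is the Gamma integral. For `-1 < q < 0` it is the Frullani formula on `[0, r]`,
and for `q = 0` on the interval between `1` and `r`. In each case the integrand is a power times a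
difference of monotone exponentials, hence of constant sign in `t`. -/
lemma subordIntegrand_spec {q r : ℝ} (hq : -1 < q) (hr : 0 < r) :
    IntegrableOn (subordIntegrand q r) (Set.Ioi 0) ∧
    ∫ t in Set.Ioi (0 : ℝ), subordIntegrand q r t = gaussMoment q r ∧
    ((∀ t, 0 < t → 0 ≤ subordIntegrand q r t) ∨ (∀ t, 0 < t → subordIntegrand q r t ≤ 0)) := by
  rcases lt_trichotomy q 0 with hq0 | rfl | hq0
  · have hi : IntervalIntegrable (fun ρ : ℝ => ρ ^ (-q - 1)) volume 0 r :=
      intervalIntegral.intervalIntegrable_rpow' (by linarith)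
    obtain ⟨h1, h2⟩ := integral_rpow_mul_exp_sub_exp hq le_rfl hr.le hi
    have e : ∀ t : ℝ, subordIntegrand q r t =
        -(t ^ (q - 1) * (Real.exp (-(0 * t)) - Real.exp (-(r * t)))) := by
      intro t
      simp only [subordIntegrand, compensator, if_neg (not_lt.2 hq0.le), if_neg hq0.ne, zero_mul,
        neg_zero, Real.exp_zero]
      ring
    have e' : subordIntegrand q r = fun t =>
      -(t ^ (q - 1) * (Real.exp (-(0 * t)) - Real.exp (-(r * t)))) := funext e
    refine ⟨?_, ?_, Or.inr fun t ht => ?_⟩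
    · rw [e']; exact h1.neg
    · simp only [e]
      rw [integral_neg, h2, gaussMoment, if_neg hq0.ne, integral_rpow (Or.inl (by linarith)),
        Real.Gamma_add_one hq0.ne]
      -- Since `-q > 0` the endpoint `0` contributes nothing; `Γ(q+1) = q Γ(q)` then absorbs the
      -- factor `1/(-q)` and the sign.
      rw [show -q - 1 + 1 = -q by ring, Real.zero_rpow (by linarith)]
      have := hq0.ne
      field_simp
      ring
    · rw [e, neg_nonpos]
      refine mul_nonneg (by positivity) (sub_nonneg.2 (Real.exp_le_exp.2 ?_))
      nlinarith
  · have hc : ∀ t, compensator 0 t = Real.exp (-(1 * t)) := by intro t; simp [compensator]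
    have hinv : ∀ a b : ℝ, 0 < a → 0 < b →
        IntervalIntegrable (fun ρ : ℝ => ρ ^ (-(0 : ℝ) - 1)) volume a b := fun a b ha hb =>
      intervalIntegral.intervalIntegrable_rpow (Or.inr (Set.notMem_uIcc_of_lt ha hb))
    have hval : ∀ a b : ℝ, 0 < a → 0 < b → ∫ ρ in a..b, ρ ^ (-(0 : ℝ) - 1) = Real.log (b / a) := by
      intro a b ha hb
      rw [← integral_inv_of_pos ha hb]
      congr 1; ext ρ
      rw [neg_zero, zero_sub, Real.rpow_neg_one]
    rcases le_total r 1 with hr1 | hr1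
    · obtain ⟨h1, h2⟩ := integral_rpow_mul_exp_sub_exp hq hr.le hr1 (hinv _ _ hr one_pos)
      have e' : subordIntegrand 0 r = fun t =>
          t ^ ((0 : ℝ) - 1) * (Real.exp (-(r * t)) - Real.exp (-(1 * t))) := by
        ext t; rw [subordIntegrand, hc]
      refine ⟨e' ▸ h1, ?_, Or.inl fun t ht => ?_⟩
      · rw [e', h2, hval _ _ hr one_pos, gaussMoment, if_pos rfl]
        simp
      · rw [e']
        refine mul_nonneg (by positivity) (sub_nonneg.2 (Real.exp_le_exp.2 ?_))
        nlinarith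
    · obtain ⟨h1, h2⟩ := integral_rpow_mul_exp_sub_exp hq zero_le_one hr1 (hinv _ _ one_pos hr)
      have e' : subordIntegrand 0 r = fun t =>
          -(t ^ ((0 : ℝ) - 1) * (Real.exp (-(1 * t)) - Real.exp (-(r * t)))) := by
        ext t; rw [subordIntegrand, hc]; ring
      refine ⟨e' ▸ h1.neg, ?_, Or.inr fun t ht => ?_⟩
      · rw [e', integral_neg, h2, hval _ _ one_pos hr, gaussMoment, if_pos rfl]
        simp
      · rw [e', neg_nonpos]
        refine mul_nonneg (by positivity) (sub_nonneg.2 (Real.exp_le_exp.2 ?_))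
        nlinarith
  · have e' : subordIntegrand q r = fun t => t ^ (q - 1) * Real.exp (-(r * t)) := by
      ext t; simp [subordIntegrand, compensator, hq0]
    refine ⟨?_, ?_, Or.inl fun t ht => ?_⟩
    · rw [e']; exact integrableOn_rpow_mul_exp_neg (by linarith) hr
    · rw [e', integral_rpow_mul_exp_neg (by linarith) hr, gaussMoment, if_neg hq0.ne']
      congr 2 <;> ring
    · rw [e']; positivity

/-- Because of the constant sign no absolute integrability is lost: the `L¹` norm in `t` is the
modulus of `Φ` up to the constant. This is what justifies Fubini in the inversion formula. -/
lemma integral_abs_subordIntegrand {q r : ℝ} (hq : -1 < q) (hr : 0 < r) :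
    ∫ t in Set.Ioi (0 : ℝ), ‖subordIntegrand q r t‖ = |gaussMoment q r| := by
  obtain ⟨-, h2, h3 | h3⟩ := subordIntegrand_spec hq hr
  · have e : ∫ t in Set.Ioi (0 : ℝ), ‖subordIntegrand q r t‖ =
        ∫ t in Set.Ioi (0 : ℝ), subordIntegrand q r t :=
      setIntegral_congr_fun measurableSet_Ioi fun t ht => Real.norm_of_nonneg (h3 t ht)
    have h0 : 0 ≤ ∫ t in Set.Ioi (0 : ℝ), subordIntegrand q r t :=
      setIntegral_nonneg measurableSet_Ioi fun t ht => h3 t ht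
    rw [e, ← h2, abs_of_nonneg h0]
  · have e : ∫ t in Set.Ioi (0 : ℝ), ‖subordIntegrand q r t‖ =
        ∫ t in Set.Ioi (0 : ℝ), -subordIntegrand q r t :=
      setIntegral_congr_fun measurableSet_Ioi fun t ht => Real.norm_of_nonpos (h3 t ht)
    have h0 : ∫ t in Set.Ioi (0 : ℝ), subordIntegrand q r t ≤ 0 :=
      setIntegral_nonpos measurableSet_Ioi fun t ht => h3 t ht
    rw [e, integral_neg, ← h2, abs_of_nonpos h0]

/-- The constant in `Φ(z) = A ∫ τ ^ (q-1) (exp (-τ ‖z‖²) - c(τ)) dτ`, `q = n/2 - s`. -/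
def subordConst (n : ℕ) (s : ℝ) : ℝ :=
  ((2 : ℝ) ^ (2 * s) * Real.pi ^ ((n : ℝ) / 2) * Real.Gamma s)⁻¹

lemma subordConst_pos (n : ℕ) {s : ℝ} (hs0 : 0 < s) : 0 < subordConst n s := by
  have := Real.Gamma_pos_of_pos hs0
  unfold subordConst; positivity

/-- In the logarithmic case `n = 1`, `s = 1/2`, the constant is `1/(2π)` and the `2` cancels with
`log ‖z‖² = 2 log ‖z‖`. Otherwise `(‖z‖²) ^ (-q) = ‖z‖ ^ (2s - n)`. -/
lemma fundSol_eq {n : ℕ} [NeZero n] {s : ℝ} (hs1 : s < 1)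
    {z : EuclideanSpace ℝ (Fin n)} (hz : z ≠ 0) :
    fundSol s z = subordConst n s * gaussMoment ((n : ℝ) / 2 - s) (‖z‖ ^ 2) := by
  have hz' : 0 < ‖z‖ := norm_pos_iff.2 hz
  unfold fundSol gaussMoment subordConst
  by_cases h : (n : ℝ) = 2 * s
  · have hn1 : n = 1 := by
      have h1 : (n : ℝ) < 2 := by linarith
      have h2 : n < 2 := by exact_mod_cast h1
      have h3 : n ≠ 0 := NeZero.ne n
      omega
    have hs : s = 1 / 2 := by rw [hn1] at h; push_cast at h; linarith
    rw [if_pos h, if_pos (by linarith), hs, Real.Gamma_one_half_eq, Real.log_pow]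
    have e : Real.pi ^ ((n : ℝ) / 2) = √Real.pi := by
      rw [Real.sqrt_eq_rpow, h, hs]; norm_num
    have e2 : (2 : ℝ) ^ (2 * (1 / 2 : ℝ)) = 2 := by norm_num
    rw [e, e2, mul_assoc, Real.mul_self_sqrt Real.pi_pos.le]
    push_cast
    have := Real.pi_ne_zero
    field_simp
  · rw [if_neg h, if_neg (by intro h'; apply h; linarith)]
    have e : (‖z‖ ^ 2) ^ (-((n : ℝ) / 2 - s)) = ‖z‖ ^ (2 * s - (n : ℝ)) := by
      rw [← Real.rpow_natCast, ← Real.rpow_mul hz'.le]; congr 1; push_cast; ring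
    rw [e]
    ring

/-- The Gamma integral after the inversion `τ ↦ 1 / τ`. -/
lemma integral_rpow_mul_exp_neg_div {s a : ℝ} (hs0 : 0 < s) (ha : 0 < a) :
    IntegrableOn (fun t : ℝ => t ^ (-s - 1) * Real.exp (-(a / t))) (Set.Ioi 0) ∧
    ∫ t in Set.Ioi (0 : ℝ), t ^ (-s - 1) * Real.exp (-(a / t)) = Real.Gamma s * a ^ (-s) := by
  set g : ℝ → ℝ := fun t => t ^ (s - 1) * Real.exp (-(a * t)) with hg
  have hpt : ∀ t ∈ Set.Ioi (0 : ℝ), (|(-1 : ℝ)| * t ^ ((-1 : ℝ) - 1)) • g (t ^ (-1 : ℝ)) =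
      t ^ (-s - 1) * Real.exp (-(a / t)) := by
    intro t ht
    have ht' : (0 : ℝ) < t := ht
    simp only [hg, smul_eq_mul, abs_neg, abs_one, one_mul]
    rw [← Real.rpow_mul ht'.le, ← mul_assoc, ← Real.rpow_add ht', Real.rpow_neg_one,
      ← div_eq_mul_inv]
    congr 2; ring
  have hgi : IntegrableOn g (Set.Ioi 0) := integrableOn_rpow_mul_exp_neg (by linarith) ha
  constructor
  · refine ((integrableOn_Ioi_comp_rpow_iff g (p := -1) (by norm_num)).2 hgi).congr_fun hpt
      measurableSet_Ioi
  · rw [← setIntegral_congr_fun measurableSet_Ioi hpt, integral_comp_rpow_Ioi g (by norm_num),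
      hg, integral_rpow_mul_exp_neg (by linarith) ha]
    congr 2 <;> ring

end Subordination

/-! ### Bounds for the fundamental solution -/

section FundSolBounds

variable {n : ℕ}

lemma measurable_fundSol (s : ℝ) :
    Measurable (fundSol s : EuclideanSpace ℝ (Fin n) → ℝ) := by
  unfold fundSol
  split_ifs
  · exact (Real.measurable_log.comp measurable_norm).const_mul _
  · exact (measurable_norm.pow_const _).const_mul _

lemma fundSol_neg (s : ℝ) (z : EuclideanSpace ℝ (Fin n)) : fundSol s (-z) = fundSol s z := by
  simp [fundSol]

lemma eq_one_of_le_two_mul [NeZero n] {s : ℝ} (hs1 : s < 1) (h : (n : ℝ) ≤ 2 * s) : n = 1 := by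
  have h1 : (n : ℝ) < 2 := by linarith
  have h2 : n < 2 := by exact_mod_cast h1
  have h3 : n ≠ 0 := NeZero.ne n
  omega

/-- The fundamental solution is bounded by a radial function with an integrable singularity at
the origin and sublinear growth at infinity; there is no growth if `2 s < n`. -/
lemma exists_abs_fundSol_le_radialPow [NeZero n] {s : ℝ} (hs0 : 0 < s) (hs1 : s < 1) :
    ∃ σ : ℝ, 0 ≤ σ ∧ σ < 2 * s ∧ (2 * s < n → σ = 0) ∧ ∃ b C : ℝ, -(n : ℝ) < b ∧ 0 ≤ C ∧
      ∀ z : EuclideanSpace ℝ (Fin n), |fundSol s z| ≤ C * radialPow b σ z := by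
  by_cases hlt : 2 * s < n
  · refine ⟨0, le_rfl, by linarith, fun _ => rfl, 2 * s - n, _, by linarith,
      abs_nonneg (Real.Gamma ((n : ℝ) / 2 - s) /
        ((2 : ℝ) ^ (2 * s) * Real.pi ^ ((n : ℝ) / 2) * Real.Gamma s)), fun z => ?_⟩
    rw [fundSol, if_neg hlt.ne', abs_mul]
    gcongr
    rw [abs_of_nonneg (by positivity), radialPow]
    split_ifs with hz
    · exact le_rfl
    · exact Real.rpow_le_rpow_of_exponent_le (not_le.1 hz).le (by linarith)
  · have hle : (n : ℝ) ≤ 2 * s := not_lt.1 hlt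
    have hn : n = 1 := eq_one_of_le_two_mul hs1 hle
    have hn' : (n : ℝ) = 1 := by rw [hn]; norm_num
    by_cases heq : (n : ℝ) = 2 * s
    · have hs : s = 1 / 2 := by linarith
      -- The elementary bound `log t ≤ 2 t ^ (1/2)`, applied to `‖z‖` and to `‖z‖⁻¹`, gives the
      -- exponents `1/2 = s` at infinity and `-1/2` at the origin. At `z = 0` the logarithm takes
      -- its default value `0`.
      refine ⟨s, hs0.le, by linarith, fun h => absurd h hlt, -(1 / 2), 1 / Real.pi * 2,
        by rw [hn']; norm_num, by positivity, fun z => ?_⟩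
      rw [fundSol, if_pos heq, abs_mul, abs_neg, abs_of_nonneg (by positivity : 0 ≤ 1 / Real.pi),
        mul_assoc]
      gcongr
      rw [radialPow]
      rcases eq_or_ne z 0 with rfl | hz0
      · simp
      have hz' : 0 < ‖z‖ := norm_pos_iff.2 hz0
      split_ifs with hz
      · rw [abs_of_nonpos (Real.log_nonpos hz'.le hz), ← Real.log_inv]
        refine (Real.log_le_rpow_div (by positivity) (by norm_num : (0 : ℝ) < 1 / 2)).trans ?_
        rw [Real.inv_rpow hz'.le, Real.rpow_neg hz'.le]
        linarith
      · rw [abs_of_nonneg (Real.log_nonneg (not_le.1 hz).le), hs]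
        refine (Real.log_le_rpow_div hz'.le (by norm_num : (0 : ℝ) < 1 / 2)).trans ?_
        linarith
    -- Here `n = 1` and `2s - 1 ≤ s`, since `s < 1`.
    · refine ⟨s, hs0.le, by linarith, fun h => absurd h hlt, 2 * s - n, _, by linarith,
        abs_nonneg (Real.Gamma ((n : ℝ) / 2 - s) /
        ((2 : ℝ) ^ (2 * s) * Real.pi ^ ((n : ℝ) / 2) * Real.Gamma s)), fun z => ?_⟩
      rw [fundSol, if_neg heq, abs_mul]
      gcongr
      rw [abs_of_nonneg (by positivity), radialPow]
      split_ifs with hz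
      · exact le_rfl
      · exact Real.rpow_le_rpow_of_exponent_le (not_le.1 hz).le (by linarith)

/-- The fundamental solution is the sum of an integrable function and a function of moderate
growth. -/
lemma exists_abs_fundSol_le [NeZero n] {s : ℝ} (hs0 : 0 < s) (hs1 : s < 1) :
    ∃ σ : ℝ, 0 ≤ σ ∧ σ < 2 * s ∧ (2 * s < n → σ = 0) ∧
      ∃ k : EuclideanSpace ℝ (Fin n) → ℝ, Integrable k ∧ (∀ z, 0 ≤ k z) ∧
      ∃ C : ℝ, 0 ≤ C ∧ ∀ z, |fundSol s z| ≤ k z + C * (1 + ‖z‖) ^ σ := by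
  obtain ⟨σ, hσ0, hσ, hσn, b, C, hb, hC0, hC⟩ :=
    exists_abs_fundSol_le_radialPow (n := n) hs0 hs1
  refine ⟨σ, hσ0, hσ, hσn, fun z => C * radialPow b (-((n : ℝ) + 1)) z,
    (integrable_radialPow_euclidean hb (by linarith)).const_mul C,
    fun z => mul_nonneg hC0 (radialPow_nonneg _ _ _), C, hC0, fun z => ?_⟩
  refine (hC z).trans ?_
  rw [← mul_add]
  gcongr
  unfold radialPow
  split_ifs with hz
  · have : 0 ≤ (1 + ‖z‖) ^ σ := by positivity
    linarith
  · have h1 : ‖z‖ ^ σ ≤ (1 + ‖z‖) ^ σ :=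
      Real.rpow_le_rpow (norm_nonneg _) (by linarith) hσ0
    have : 0 ≤ ‖z‖ ^ (-((n : ℝ) + 1)) := by positivity
    linarith

lemma integrable_fundSol_mul [NeZero n] {s : ℝ} (hs0 : 0 < s) (hs1 : s < 1)
    {ψ : EuclideanSpace ℝ (Fin n) → ℝ} (hψ : Continuous ψ) {B : ℝ}
    (hB : ∀ x, |ψ x| ≤ B * (1 + ‖x‖) ^ (-((n : ℝ) + 2 * s))) (x : EuclideanSpace ℝ (Fin n)) :
    Integrable fun z => fundSol s z * ψ (x - z) := by
  obtain ⟨σ, hσ0, hσ, -, k, hk, hk0, C, hC0, hC⟩ := exists_abs_fundSol_le (n := n) hs0 hs1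
  set p := (n : ℝ) + 2 * s with hp
  have hp0 : 0 ≤ p := by rw [hp]; positivity
  have hB0 : 0 ≤ B := by
    have := (abs_nonneg _).trans (hB 0)
    simpa using this
  refine Integrable.mono' ((hk.mul_const B).add ((integrable_rpow_one_add_norm (n := n)
    (r := p - σ) (by linarith)).const_mul (C * B * (1 + ‖x‖) ^ p))) ?_ ?_
  · exact (measurable_fundSol s).aestronglyMeasurable.mul
      (hψ.comp (by fun_prop)).aestronglyMeasurable
  · filter_upwards with z
    have hz : 0 < 1 + ‖z‖ := by positivity
    have hw : 0 < 1 + ‖x - z‖ := by positivity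
    have h1 : |ψ (x - z)| ≤ B := (hB _).trans (mul_le_of_le_one_right hB0
      (Real.rpow_le_one_of_one_le_of_nonpos (by simp) (by linarith)))
    -- Decay about `x` is turned into decay about the origin, to be used on the growing part of `Φ`;
    -- the integrable part only needs the uniform bound `B`.
    have h2 : |ψ (x - z)| ≤ B * ((1 + ‖x‖) ^ p * (1 + ‖z‖) ^ (-p)) := by
      refine (hB _).trans ?_
      gcongr
      rw [Real.rpow_neg hw.le, Real.rpow_neg hz.le, ← div_eq_mul_inv, inv_eq_one_div,
        div_le_div_iff₀ (by positivity) (by positivity), one_mul]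
      have := one_add_norm_rpow_le_mul hp0 z (-x)
      rw [norm_neg, ← sub_eq_add_neg, norm_sub_rev z x] at this
      linarith
    rw [norm_mul, Real.norm_eq_abs, Real.norm_eq_abs, Pi.add_apply]
    calc |fundSol s z| * |ψ (x - z)| ≤ (k z + C * (1 + ‖z‖) ^ σ) * |ψ (x - z)| := by
          gcongr; exact hC z
      _ = k z * |ψ (x - z)| + C * (1 + ‖z‖) ^ σ * |ψ (x - z)| := by ring
      _ ≤ k z * B + C * (1 + ‖z‖) ^ σ * (B * ((1 + ‖x‖) ^ p * (1 + ‖z‖) ^ (-p))) := by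
          have := hk0 z
          gcongr
      _ = k z * B + C * B * (1 + ‖x‖) ^ p * ((1 + ‖z‖) ^ σ * (1 + ‖z‖) ^ (-p)) := by ring
      _ = _ := by
          rw [← Real.rpow_add hz]; congr 3; ring

end FundSolBounds

/-! ### The fundamental solution inverts the fractional Laplacian of Schwartz functions -/

section Inversion

variable {n : ℕ}

lemma integral_gaussian_mul_expInner {t : ℝ} (ht : 0 < t) (ξ : EuclideanSpace ℝ (Fin n)) :
    ∫ z : EuclideanSpace ℝ (Fin n), ((Real.exp (-(‖z‖ ^ 2 * t)) : ℝ) : ℂ) * expInner ξ (-z) =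
      (((Real.pi / t) ^ ((n : ℝ) / 2) * Real.exp (-((Real.pi * ‖ξ‖) ^ 2 / t)) : ℝ) : ℂ) := by
  have h := GaussianFourier.integral_cexp_neg_mul_sq_norm_add (b := (t : ℂ)) (by simpa using ht)
    (-(2 * Real.pi * Complex.I)) ξ
  have e : ∀ z : EuclideanSpace ℝ (Fin n),
      ((Real.exp (-(‖z‖ ^ 2 * t)) : ℝ) : ℂ) * expInner ξ (-z) =
      Complex.exp (-(t : ℂ) * ‖z‖ ^ 2 + -(2 * Real.pi * Complex.I) * ⟪ξ, z⟫) := by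
    intro z
    rw [expInner, Complex.ofReal_exp, ← Complex.exp_add, inner_neg_right]
    congr 1; push_cast; ring
  simp only [e]
  rw [h, finrank_euclideanSpace_fin, Complex.ofReal_mul, Complex.ofReal_exp,
    Complex.ofReal_cpow (by positivity)]
  push_cast
  congr 2
  have : (t : ℂ) ≠ 0 := by exact_mod_cast ht.ne'
  field_simp
  rw [Complex.I_sq]
  ring

lemma integrable_gaussian {t : ℝ} (ht : 0 < t) :
    Integrable fun z : EuclideanSpace ℝ (Fin n) => Real.exp (-(‖z‖ ^ 2 * t)) := by
  have h := (GaussianFourier.integrable_cexp_neg_mul_sq_norm_add (b := (t : ℂ))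
    (by simpa using ht) 0 (0 : EuclideanSpace ℝ (Fin n))).norm
  refine h.congr (Eventually.of_forall fun z => ?_)
  simp only [zero_mul, add_zero]
  rw [Complex.norm_exp]
  congr 1
  rw [← Complex.ofReal_neg, ← Complex.ofReal_pow, ← Complex.ofReal_mul, Complex.ofReal_re]
  ring

/-- The radial factor arising from the subordination of the multiplier. -/
lemma gaussian_weight_eq (s : ℝ) {ξ : EuclideanSpace ℝ (Fin n)} {t : ℝ} (ht : 0 < t) :
    t ^ ((n : ℝ) / 2 - s - 1) * (‖(2 * Real.pi) • ξ‖ ^ (2 * s) *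
      ((Real.pi / t) ^ ((n : ℝ) / 2) * Real.exp (-((Real.pi * ‖ξ‖) ^ 2 / t)))) =
    (‖(2 * Real.pi) • ξ‖ ^ (2 * s) * Real.pi ^ ((n : ℝ) / 2)) *
      (t ^ (-s - 1) * Real.exp (-((Real.pi * ‖ξ‖) ^ 2 / t))) := by
  rw [Real.div_rpow Real.pi_pos.le ht.le,
    show (n : ℝ) / 2 - s - 1 = (n : ℝ) / 2 + (-s - 1) by ring, Real.rpow_add ht]
  have : t ^ ((n : ℝ) / 2) ≠ 0 := by positivity
  field_simp

/-- The powers `t ^ (n/2)` cancel, and the remaining Gamma integral gives `Γ(s) (π‖ξ‖) ^ (-2s)`,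
whose dependence on `ξ` is cancelled by the multiplier. The value fixes the constant in `Φ`. -/
lemma integral_gaussian_weight {s : ℝ} (hs0 : 0 < s) {ξ : EuclideanSpace ℝ (Fin n)} (hξ : ξ ≠ 0) :
    IntegrableOn (fun t : ℝ => t ^ ((n : ℝ) / 2 - s - 1) * (‖(2 * Real.pi) • ξ‖ ^ (2 * s) *
      ((Real.pi / t) ^ ((n : ℝ) / 2) * Real.exp (-((Real.pi * ‖ξ‖) ^ 2 / t))))) (Set.Ioi 0) ∧
    ∫ t in Set.Ioi (0 : ℝ), t ^ ((n : ℝ) / 2 - s - 1) * (‖(2 * Real.pi) • ξ‖ ^ (2 * s) *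
      ((Real.pi / t) ^ ((n : ℝ) / 2) * Real.exp (-((Real.pi * ‖ξ‖) ^ 2 / t)))) =
      (subordConst n s)⁻¹ := by
  have hξ' : 0 < ‖ξ‖ := norm_pos_iff.2 hξ
  have ha : 0 < (Real.pi * ‖ξ‖) ^ 2 := by positivity
  obtain ⟨h1, h2⟩ := integral_rpow_mul_exp_neg_div hs0 ha
  constructor
  · exact IntegrableOn.congr_fun
      (h1.const_mul (‖(2 * Real.pi) • ξ‖ ^ (2 * s) * Real.pi ^ ((n : ℝ) / 2)))
      (fun t ht => (gaussian_weight_eq s ht).symm) measurableSet_Ioi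
  · rw [setIntegral_congr_fun measurableSet_Ioi fun t ht => gaussian_weight_eq (ξ := ξ) s ht,
      integral_const_mul, h2, subordConst, inv_inv, norm_smul,
      Real.norm_of_nonneg (by positivity : 0 ≤ 2 * Real.pi), mul_assoc 2 Real.pi,
      Real.mul_rpow zero_le_two (by positivity)]
    have e : (Real.pi * ‖ξ‖) ^ (2 * s) * ((Real.pi * ‖ξ‖) ^ 2) ^ (-s) = 1 := by
      rw [← Real.rpow_natCast, ← Real.rpow_mul (by positivity), ← Real.rpow_add (by positivity)]
      convert Real.rpow_zero _ using 2
      push_cast; ring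
    linear_combination (2 ^ (2 * s) * Real.pi ^ ((n : ℝ) / 2) * Real.Gamma s) * e

variable [NeZero n] {s : ℝ}

/-- The fractional Laplacian of a Schwartz function. -/
def schwartzFracLap (s : ℝ) (φ : 𝓢(EuclideanSpace ℝ (Fin n), ℝ))
    (x : EuclideanSpace ℝ (Fin n)) : ℝ :=
  normConst n s / 2 * symmIntegral ((n : ℝ) + 2 * s) φ x

lemma continuous_schwartzFracLap (hs0 : 0 < s) (hs1 : s < 1)
    (φ : 𝓢(EuclideanSpace ℝ (Fin n), ℝ)) : Continuous (schwartzFracLap s φ) :=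
  (memSs_symmIntegral hs0 hs1 (normConst n s / 2) φ).1.continuous

lemma exists_abs_schwartzFracLap_le (hs0 : 0 < s) (hs1 : s < 1)
    (φ : 𝓢(EuclideanSpace ℝ (Fin n), ℝ)) : ∃ B : ℝ, 0 ≤ B ∧
      ∀ x, |schwartzFracLap s φ x| ≤ B * (1 + ‖x‖) ^ (-((n : ℝ) + 2 * s)) := by
  obtain ⟨C, hC0, hC⟩ := exists_weight_mul_integral_le (n := n) (p := n + 2 * s)
    (by linarith) (by linarith) φ
  have hN := normConst_pos (n := n) hs0 hs1
  refine ⟨normConst n s / 2 * C, by positivity, fun x => ?_⟩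
  have hx : 0 < 1 + ‖x‖ := by positivity
  rw [schwartzFracLap, abs_mul, abs_of_nonneg (by positivity), mul_assoc]
  gcongr
  rw [Real.rpow_neg hx.le, ← div_eq_mul_inv, le_div_iff₀ (by positivity), mul_comm]
  refine le_trans ?_ (hC x)
  gcongr
  exact norm_integral_le_integral_norm
    (fun y => (‖y‖ ^ ((n : ℝ) + 2 * s))⁻¹ • secondDiff φ x y)

lemma integrable_schwartzFracLap (hs0 : 0 < s) (hs1 : s < 1)
    (φ : 𝓢(EuclideanSpace ℝ (Fin n), ℝ)) : Integrable (schwartzFracLap s φ) := by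
  obtain ⟨B, -, hB⟩ := exists_abs_schwartzFracLap_le hs0 hs1 φ
  exact ((integrable_rpow_one_add_norm (by linarith)).const_mul B).mono'
    (continuous_schwartzFracLap hs0 hs1 φ).aestronglyMeasurable (Eventually.of_forall hB)

lemma integral_schwartzFracLap (hs0 : 0 < s) (hs1 : s < 1)
    (φ : 𝓢(EuclideanSpace ℝ (Fin n), ℝ)) : ∫ x, schwartzFracLap s φ x = 0 := by
  simp only [schwartzFracLap]
  rw [integral_const_mul, integral_symmIntegral_schwartz hs0 hs1, mul_zero]

/-- Insert the Fourier representation of `(-Δ)^s φ` and integrate in `z` first; this replaces the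
Gaussian by its Fourier transform. -/
lemma integral_gaussian_mul_schwartzFracLap (hs0 : 0 < s) (hs1 : s < 1)
    (φ : 𝓢(EuclideanSpace ℝ (Fin n), ℝ)) (x : EuclideanSpace ℝ (Fin n)) {t : ℝ} (ht : 0 < t) :
    ((∫ z, Real.exp (-(‖z‖ ^ 2 * t)) * schwartzFracLap s φ (x - z) : ℝ) : ℂ) =
      ∫ ξ, fourierReal φ ξ * expInner ξ x *
        ((‖(2 * Real.pi) • ξ‖ ^ (2 * s) *
          ((Real.pi / t) ^ ((n : ℝ) / 2) * Real.exp (-((Real.pi * ‖ξ‖) ^ 2 / t))) : ℝ) : ℂ) := by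
  set G : EuclideanSpace ℝ (Fin n) → EuclideanSpace ℝ (Fin n) → ℂ := fun z ξ =>
    ((Real.exp (-(‖z‖ ^ 2 * t)) : ℝ) : ℂ) * (fourierReal φ ξ * expInner ξ (x - z) *
      ((‖(2 * Real.pi) • ξ‖ ^ (2 * s) : ℝ) : ℂ)) with hG
  have hi : Integrable (Function.uncurry G) (volume.prod volume) := by
    refine ((integrable_gaussian (n := n) ht).mul_prod
      (integrable_fourierReal_mul_rpow hs0 φ)).mono' ?_ ?_
    · refine Continuous.aestronglyMeasurable ?_
      have h1 : Continuous fun z : EuclideanSpace ℝ (Fin n) × EuclideanSpace ℝ (Fin n) =>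
          fourierReal φ z.2 := (fourierReal φ).continuous.comp continuous_snd
      have h2 : Continuous fun z : EuclideanSpace ℝ (Fin n) × EuclideanSpace ℝ (Fin n) =>
          expInner z.2 (x - z.1) :=
        continuous_expInner.comp (continuous_snd.prodMk (continuous_const.sub continuous_fst))
      have h3 : Continuous fun z : EuclideanSpace ℝ (Fin n) × EuclideanSpace ℝ (Fin n) =>
          ‖(2 * Real.pi) • z.2‖ ^ (2 * s) :=
        Continuous.rpow_const (by fun_prop) fun _ => Or.inr (by positivity)
      have h4 : Continuous fun z : EuclideanSpace ℝ (Fin n) × EuclideanSpace ℝ (Fin n) =>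
          Real.exp (-(‖z.1‖ ^ 2 * t)) := by fun_prop
      exact Continuous.mul (Complex.continuous_ofReal.comp h4)
        (Continuous.mul (Continuous.mul h1 h2) (Complex.continuous_ofReal.comp h3))
    · filter_upwards with z
      simp only [Function.uncurry, hG]
      rw [norm_mul, norm_mul, norm_mul, norm_expInner, mul_one, Complex.norm_real,
        Complex.norm_real, Real.norm_of_nonneg (by positivity), Real.norm_of_nonneg (by positivity)]
  have hswap := integral_integral_swap hi
  have e1 : ∫ z, ∫ ξ, G z ξ =
      ((∫ z, Real.exp (-(‖z‖ ^ 2 * t)) * schwartzFracLap s φ (x - z) : ℝ) : ℂ) := by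
    rw [← integral_complex_ofReal]
    congr 1; ext z
    rw [Complex.ofReal_mul, schwartzFracLap, ofReal_symmIntegral_eq hs0 hs1, ← integral_const_mul]
  rw [← e1, hswap]
  congr 1; ext ξ
  have e2 : ∀ z, G z ξ = fourierReal φ ξ * expInner ξ x *
      ((‖(2 * Real.pi) • ξ‖ ^ (2 * s) : ℝ) : ℂ) *
      (((Real.exp (-(‖z‖ ^ 2 * t)) : ℝ) : ℂ) * expInner ξ (-z)) := by
    intro z
    simp only [hG]
    rw [expInner_sub]
    ring
  simp only [e2]
  rw [integral_const_mul, integral_gaussian_mul_expInner ht, mul_assoc, ← Complex.ofReal_mul]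

lemma ae_ne_zero : ∀ᵐ z : EuclideanSpace ℝ (Fin n), z ≠ 0 := by
  have : Nonempty (Fin n) := ⟨0⟩
  exact Measure.ae_ne volume 0

/-- The fundamental solution is a left inverse of the fractional Laplacian on Schwartz
functions. -/
theorem integral_fundSol_mul_schwartzFracLap (hs0 : 0 < s) (hs1 : s < 1)
    (φ : 𝓢(EuclideanSpace ℝ (Fin n), ℝ)) (x : EuclideanSpace ℝ (Fin n)) :
    ∫ z, fundSol s z * schwartzFracLap s φ (x - z) = φ x := by
  obtain ⟨B, hB0, hB⟩ := exists_abs_schwartzFracLap_le hs0 hs1 φ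
  have hΨc := continuous_schwartzFracLap hs0 hs1 φ
  have hA := subordConst_pos n hs0
  have hn : (1 : ℝ) ≤ n := by exact_mod_cast NeZero.one_le
  set q : ℝ := (n : ℝ) / 2 - s with hq
  have hq1 : -1 < q := by rw [hq]; linarith
  set Ψ : EuclideanSpace ℝ (Fin n) → ℝ := fun z => schwartzFracLap s φ (x - z) with hΨ
  have hΨi : Integrable Ψ := (integrable_schwartzFracLap hs0 hs1 φ).comp_sub_left x
  have hΨ0 : ∫ z, Ψ z = 0 := by
    rw [hΨ, integral_sub_left_eq_self (schwartzFracLap s φ) volume x,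
      integral_schwartzFracLap hs0 hs1]
  have hΦΨ : Integrable fun z => fundSol s z * Ψ z := integrable_fundSol_mul hs0 hs1 hΨc hB x
  -- the first application of Fubini's theorem
  set F : EuclideanSpace ℝ (Fin n) → ℝ → ℝ := fun z t => subordIntegrand q (‖z‖ ^ 2) t * Ψ z
    with hF
  have hFm : AEStronglyMeasurable (Function.uncurry F)
      (volume.prod (volume.restrict (Set.Ioi 0))) := by
    refine AEStronglyMeasurable.mul (Measurable.aestronglyMeasurable ?_)
      (hΨi.aestronglyMeasurable.comp_fst)
    unfold subordIntegrand
    exact (measurable_snd.pow_const _).mul ((Continuous.measurable (by fun_prop)).sub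
      ((measurable_compensator q).comp measurable_snd))
  -- The absolute integral in `t` is `|Φ(z)| |Ψ(z)| / A`, and `Φ Ψ` is integrable.
  have hFi : Integrable (Function.uncurry F) (volume.prod (volume.restrict (Set.Ioi 0))) := by
    refine (integrable_prod_iff hFm).2 ⟨?_, ?_⟩
    · filter_upwards [ae_ne_zero (n := n)] with z hz
      have hz' : 0 < ‖z‖ := norm_pos_iff.2 hz
      exact Integrable.mul_const (subordIntegrand_spec hq1 (by positivity : 0 < ‖z‖ ^ 2)).1 (Ψ z)
    · refine (hΦΨ.norm.const_mul (subordConst n s)⁻¹).congr ?_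
      filter_upwards [ae_ne_zero (n := n)] with z hz
      have hz' : 0 < ‖z‖ := norm_pos_iff.2 hz
      simp only [Function.uncurry_apply_pair, hF, norm_mul]
      rw [integral_mul_const, integral_abs_subordIntegrand hq1 (by positivity : 0 < ‖z‖ ^ 2),
        fundSol_eq hs1 hz, norm_mul, Real.norm_of_nonneg hA.le, Real.norm_eq_abs,
        ← hq, mul_assoc, inv_mul_cancel_left₀ hA.ne']
  have hswap1 := integral_integral_swap hFi
  have hleft : ∫ z, ∫ t in Set.Ioi (0 : ℝ), F z t =
      (subordConst n s)⁻¹ * ∫ z, fundSol s z * Ψ z := by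
    rw [← integral_const_mul]
    refine integral_congr_ae ?_
    filter_upwards [ae_ne_zero (n := n)] with z hz
    have hz' : 0 < ‖z‖ := norm_pos_iff.2 hz
    simp only [hF]
    rw [integral_mul_const, (subordIntegrand_spec hq1 (by positivity : 0 < ‖z‖ ^ 2)).2.1,
      fundSol_eq hs1 hz, ← hq, mul_assoc, inv_mul_cancel_left₀ hA.ne']
  -- The compensator does not depend on `z`, so it multiplies the integral of `Ψ`, which is zero.
  have hright : ∀ t ∈ Set.Ioi (0 : ℝ), ∫ z, F z t =
      t ^ (q - 1) * ∫ z, Real.exp (-(‖z‖ ^ 2 * t)) * Ψ z := by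
    intro t ht
    have hg : Integrable fun z => Real.exp (-(‖z‖ ^ 2 * t)) * Ψ z := by
      refine hΨi.norm.mono' ((Continuous.aestronglyMeasurable (by fun_prop)).mul
        hΨi.aestronglyMeasurable) ?_
      filter_upwards with z
      have ht' : (0 : ℝ) < t := ht
      rw [norm_mul, Real.norm_of_nonneg (Real.exp_pos _).le]
      exact mul_le_of_le_one_left (norm_nonneg _) (Real.exp_le_one_iff.2
        (neg_nonpos.2 (by positivity)))
    have e : ∀ z, F z t = t ^ (q - 1) * (Real.exp (-(‖z‖ ^ 2 * t)) * Ψ z - compensator q t * Ψ z) := by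
      intro z; simp only [hF, subordIntegrand]; ring
    simp only [e]
    rw [integral_const_mul, integral_sub hg (hΨi.const_mul _), integral_const_mul, hΨ0, mul_zero,
      sub_zero]
  -- the second application
  set K : EuclideanSpace ℝ (Fin n) → ℝ → ℝ := fun ξ t =>
    t ^ (q - 1) * (‖(2 * Real.pi) • ξ‖ ^ (2 * s) *
      ((Real.pi / t) ^ ((n : ℝ) / 2) * Real.exp (-((Real.pi * ‖ξ‖) ^ 2 / t)))) with hK
  set G : EuclideanSpace ℝ (Fin n) → ℝ → ℂ := fun ξ t =>
    fourierReal φ ξ * expInner ξ x * ((K ξ t : ℝ) : ℂ) with hG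
  have hcont := continuous_fourierReal_mul_expInner φ x
  have hGm : AEStronglyMeasurable (Function.uncurry G)
      (volume.prod (volume.restrict (Set.Ioi 0))) := by
    refine AEStronglyMeasurable.mul (hcont.comp continuous_fst).aestronglyMeasurable
      (Measurable.aestronglyMeasurable (Complex.measurable_ofReal.comp ?_))
    exact (measurable_snd.pow_const _).mul
      (((measurable_fst.const_smul (2 * Real.pi)).norm.pow_const _).mul
        (((measurable_snd.const_div _).pow_const _).mul
          (((((measurable_fst.norm.const_mul _).pow_const 2).div measurable_snd)).neg.exp)))
  -- The kernel `K` is nonnegative with `t`-integral `1/A` for every `ξ ≠ 0`, so integrability of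
  -- the Fourier transform of `φ` suffices.
  have hGi : Integrable (Function.uncurry G) (volume.prod (volume.restrict (Set.Ioi 0))) := by
    refine (integrable_prod_iff hGm).2 ⟨?_, ?_⟩
    · filter_upwards [ae_ne_zero (n := n)] with ξ hξ
      have := (integral_gaussian_weight (n := n) hs0 hξ).1
      exact (Integrable.ofReal (𝕜 := ℂ) this).const_mul (fourierReal φ ξ * expInner ξ x)
    · refine ((fourierReal φ).integrable.norm.mul_const (subordConst n s)⁻¹).congr ?_
      filter_upwards [ae_ne_zero (n := n)] with ξ hξ
      rw [← (integral_gaussian_weight (n := n) hs0 hξ).2, ← integral_const_mul]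
      refine setIntegral_congr_fun measurableSet_Ioi fun t ht => ?_
      have ht' : (0 : ℝ) < t := ht
      simp only [Function.uncurry_apply_pair, hG]
      rw [norm_mul, norm_mul, norm_expInner, mul_one, Complex.norm_real, Real.norm_of_nonneg]
      simp only [hK]
      positivity
  have hswap2 := integral_integral_swap hGi
  have h2 : ∫ ξ, ∫ t in Set.Ioi (0 : ℝ), G ξ t = (((subordConst n s)⁻¹ * φ x : ℝ) : ℂ) := by
    rw [Complex.ofReal_mul, ← integral_fourierReal_mul_expInner φ x, ← integral_const_mul]
    refine integral_congr_ae ?_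
    filter_upwards [ae_ne_zero (n := n)] with ξ hξ
    simp only [hG]
    rw [integral_const_mul, integral_complex_ofReal, (integral_gaussian_weight (n := n) hs0 hξ).2]
    ring
  have h3 : ∫ t in Set.Ioi (0 : ℝ), ∫ ξ, G ξ t =
      ((∫ t in Set.Ioi (0 : ℝ), ∫ z, F z t : ℝ) : ℂ) := by
    rw [← integral_complex_ofReal]
    refine setIntegral_congr_fun measurableSet_Ioi fun t ht => ?_
    rw [hright t ht, Complex.ofReal_mul, integral_gaussian_mul_schwartzFracLap hs0 hs1 φ x ht,
      ← integral_const_mul]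
    congr 1; ext ξ
    simp only [hG, hK]
    push_cast
    ring
  rw [← hswap2, h2, ← hswap1, hleft] at h3
  have h4 := Complex.ofReal_injective h3
  exact (mul_left_cancel₀ (inv_ne_zero hA.ne') h4).symm

end Inversion

/-! ### Local integrals and oscillation of the fundamental solution -/

section Kernel

variable {n : ℕ}

lemma continuous_one_add_norm_rpow (σ : ℝ) :
    Continuous fun z : EuclideanSpace ℝ (Fin n) => (1 + ‖z‖) ^ σ :=
  Continuous.rpow_const (by fun_prop) fun z => Or.inl (by positivity)

variable [NeZero n] {s : ℝ}

lemma locallyIntegrable_fundSol (hs0 : 0 < s) (hs1 : s < 1) :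
    LocallyIntegrable (fundSol s : EuclideanSpace ℝ (Fin n) → ℝ) := by
  obtain ⟨σ, -, -, -, k, hk, hk0, C, hC0, hC⟩ := exists_abs_fundSol_le (n := n) hs0 hs1
  have h1 : LocallyIntegrable (fun z : EuclideanSpace ℝ (Fin n) => k z + C * (1 + ‖z‖) ^ σ) :=
    hk.locallyIntegrable.add
      ((continuous_const.mul (continuous_one_add_norm_rpow σ)).locallyIntegrable)
  refine h1.mono (measurable_fundSol s).aestronglyMeasurable (Eventually.of_forall fun z => ?_)
  have : 0 ≤ k z + C * (1 + ‖z‖) ^ σ := add_nonneg (hk0 z) (by positivity)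
  rw [Real.norm_eq_abs, Real.norm_of_nonneg this]
  exact hC z

lemma integrableOn_fundSol_closedBall (hs0 : 0 < s) (hs1 : s < 1)
    (x : EuclideanSpace ℝ (Fin n)) (R : ℝ) :
    IntegrableOn (fundSol s) (Metric.closedBall x R) :=
  (locallyIntegrable_fundSol hs0 hs1).integrableOn_isCompact (isCompact_closedBall x R)

/-- The integral of `|Φ|` over balls of a fixed radius has sublinear growth, and is bounded if
`2 s < n`. -/
lemma exists_integral_abs_fundSol_le (hs0 : 0 < s) (hs1 : s < 1) :
    ∃ σ : ℝ, 0 ≤ σ ∧ σ < 2 * s ∧ (2 * s < n → σ = 0) ∧ ∀ R : ℝ, 0 ≤ R → ∃ M : ℝ, 0 ≤ M ∧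
      ∀ x : EuclideanSpace ℝ (Fin n),
        ∫ z in Metric.closedBall x R, |fundSol s z| ≤ M * (1 + ‖x‖) ^ σ := by
  obtain ⟨σ, hσ0, hσ, hσn, k, hk, hk0, C, hC0, hC⟩ := exists_abs_fundSol_le (n := n) hs0 hs1
  refine ⟨σ, hσ0, hσ, hσn, fun R hR => ?_⟩
  set V : ℝ := (volume : Measure (EuclideanSpace ℝ (Fin n))).real (Metric.closedBall 0 R) with hV
  have hV0 : 0 ≤ V := measureReal_nonneg
  have hk' : 0 ≤ ∫ z, k z := integral_nonneg hk0
  refine ⟨(∫ z, k z) + C * (1 + R) ^ σ * V, by positivity, fun x => ?_⟩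
  have hx1 : 1 ≤ (1 + ‖x‖) ^ σ := Real.one_le_rpow (by simp) hσ0
  have hVx : (volume : Measure (EuclideanSpace ℝ (Fin n))).real (Metric.closedBall x R) = V := by
    rw [hV, measureReal_def, measureReal_def, Measure.addHaar_closedBall_center]
  have hg : IntegrableOn (fun z : EuclideanSpace ℝ (Fin n) => k z +
      C * ((1 + R) ^ σ * (1 + ‖x‖) ^ σ)) (Metric.closedBall x R) :=
    hk.integrableOn.add (integrableOn_const (measure_closedBall_lt_top.ne))
  calc ∫ z in Metric.closedBall x R, |fundSol s z|
      ≤ ∫ z in Metric.closedBall x R, (k z + C * ((1 + R) ^ σ * (1 + ‖x‖) ^ σ)) := by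
        refine setIntegral_mono_on (integrableOn_fundSol_closedBall hs0 hs1 x R).norm hg
          measurableSet_closedBall fun z hz => (hC z).trans ?_
        gcongr
        rw [← Real.mul_rpow (by positivity) (by positivity)]
        refine Real.rpow_le_rpow (by positivity) ?_ hσ0
        rw [Metric.mem_closedBall, dist_eq_norm] at hz
        have : ‖z‖ ≤ ‖z - x‖ + ‖x‖ := by simpa using norm_add_le (z - x) x
        nlinarith [norm_nonneg x]
    _ = (∫ z in Metric.closedBall x R, k z) + C * ((1 + R) ^ σ * (1 + ‖x‖) ^ σ) * V := by
        rw [integral_add hk.integrableOn (integrableOn_const (measure_closedBall_lt_top.ne)),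
          setIntegral_const, smul_eq_mul, hVx]
        ring
    _ ≤ (∫ z, k z) * (1 + ‖x‖) ^ σ + C * ((1 + R) ^ σ * (1 + ‖x‖) ^ σ) * V := by
        gcongr
        exact (setIntegral_le_integral hk (Eventually.of_forall hk0)).trans
          (le_mul_of_one_le_right hk' hx1)
    _ = _ := by ring

lemma abs_log_sub_log_le {a b : ℝ} (ha : 1 ≤ a) (hb : 1 ≤ b) :
    |Real.log a - Real.log b| ≤ |a - b| := by
  have key : ∀ a b : ℝ, 1 ≤ a → 1 ≤ b → b ≤ a → Real.log a - Real.log b ≤ a - b := by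
    intro a b ha hb hab
    rw [← Real.log_div (by linarith) (by linarith)]
    refine (Real.log_le_sub_one_of_pos (by positivity)).trans ?_
    rw [div_sub_one (by linarith), div_le_iff₀ (by linarith)]
    nlinarith
  rcases le_total b a with h | h
  · rw [abs_of_nonneg (sub_nonneg.2 (Real.log_le_log (by linarith) h)),
      abs_of_nonneg (sub_nonneg.2 h)]
    exact key a b ha hb h
  · rw [abs_sub_comm, abs_sub_comm a b,
      abs_of_nonneg (sub_nonneg.2 (Real.log_le_log (by linarith) h)),
      abs_of_nonneg (sub_nonneg.2 h)]
    exact key b a hb ha h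

lemma abs_rpow_sub_rpow_le {a b β : ℝ} (ha : 0 ≤ a) (hb : 0 ≤ b) (hβ0 : 0 ≤ β) (hβ1 : β ≤ 1) :
    |a ^ β - b ^ β| ≤ |a - b| ^ β := by
  have key : ∀ a b : ℝ, 0 ≤ b → b ≤ a → a ^ β - b ^ β ≤ (a - b) ^ β := by
    intro a b hb hab
    have := Real.rpow_add_le_add_rpow hb (sub_nonneg.2 hab) hβ0 hβ1
    rw [add_sub_cancel] at this
    linarith
  rcases le_total b a with h | h
  · rw [abs_of_nonneg (sub_nonneg.2 (Real.rpow_le_rpow hb h hβ0)), abs_of_nonneg (sub_nonneg.2 h)]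
    exact key a b hb h
  · rw [abs_sub_comm, abs_sub_comm a b, abs_of_nonneg (sub_nonneg.2 (Real.rpow_le_rpow ha h hβ0)),
      abs_of_nonneg (sub_nonneg.2 h)]
    exact key b a ha h

/-- If `n ≤ 2 s`, the fundamental solution has bounded oscillation away from the origin. -/
lemma exists_abs_fundSol_sub_le (hs1 : s < 1) (hn : (n : ℝ) ≤ 2 * s)
    {R : ℝ} (hR : 0 ≤ R) : ∃ D : ℝ, 0 ≤ D ∧ ∀ x z : EuclideanSpace ℝ (Fin n), 1 ≤ ‖x‖ → 1 ≤ ‖z‖ →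
      ‖z - x‖ ≤ R → |fundSol s z - fundSol s x| ≤ D := by
  have hn' : (n : ℝ) = 1 := by rw [eq_one_of_le_two_mul hs1 hn]; norm_num
  by_cases heq : (n : ℝ) = 2 * s
  · refine ⟨1 / Real.pi * R, by positivity, fun x z hx hz hxz => ?_⟩
    rw [fundSol, fundSol, if_pos heq, if_pos heq, ← mul_sub, abs_mul, abs_neg,
      abs_of_nonneg (by positivity : 0 ≤ 1 / Real.pi)]
    gcongr
    exact (abs_log_sub_log_le hz hx).trans ((abs_norm_sub_norm_le z x).trans hxz)
  · refine ⟨|Real.Gamma ((n : ℝ) / 2 - s) /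
        ((2 : ℝ) ^ (2 * s) * Real.pi ^ ((n : ℝ) / 2) * Real.Gamma s)| * R ^ (2 * s - n),
      by positivity, fun x z hx hz hxz => ?_⟩
    rw [fundSol, fundSol, if_neg heq, if_neg heq, ← mul_sub, abs_mul]
    gcongr
    refine (abs_rpow_sub_rpow_le (norm_nonneg _) (norm_nonneg _) (by linarith)
      (by linarith)).trans ?_
    exact Real.rpow_le_rpow (abs_nonneg _) ((abs_norm_sub_norm_le z x).trans hxz) (by linarith)

/-- The fundamental solution has bounded mean oscillation on balls of a fixed radius. -/
lemma exists_integral_abs_fundSol_sub_le (hs0 : 0 < s) (hs1 : s < 1) {R : ℝ} (hR : 0 ≤ R) :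
    ∃ M : ℝ, 0 ≤ M ∧ ∀ x : EuclideanSpace ℝ (Fin n), ∃ c : ℝ,
      ∫ z in Metric.closedBall x R, |fundSol s z - c| ≤ M := by
  obtain ⟨σ, hσ0, -, hσn, h⟩ := exists_integral_abs_fundSol_le (n := n) hs0 hs1
  obtain ⟨M, hM0, hM⟩ := h R hR
  rcases lt_or_ge (2 * s) n with hlt | hle
  · refine ⟨M, hM0, fun x => ⟨0, ?_⟩⟩
    have := hM x
    rw [hσn hlt, Real.rpow_zero, mul_one] at this
    simpa using this
  · obtain ⟨D, hD0, hD⟩ := exists_abs_fundSol_sub_le hs1 hle hR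
    set V : ℝ := (volume : Measure (EuclideanSpace ℝ (Fin n))).real (Metric.closedBall 0 R) with hV
    have hV0 : 0 ≤ V := measureReal_nonneg
    refine ⟨M * (2 + R) ^ σ + D * V, by positivity, fun x => ?_⟩
    -- Near the origin the growth bound with `c = 0` is already uniform. If `‖x‖ > R + 1`, the ball
    -- stays outside the unit ball, and the oscillation about `c = Φ(x)` is at most `D`.
    rcases le_or_gt ‖x‖ (R + 1) with hx | hx
    · refine ⟨0, ?_⟩
      simp only [sub_zero]
      have h0 : 1 + ‖x‖ ≤ 2 + R := by linarith
      have h1 : M * (1 + ‖x‖) ^ σ ≤ M * (2 + R) ^ σ := by gcongr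
      have : 0 ≤ D * V := by positivity
      linarith [hM x]
    · refine ⟨fundSol s x, ?_⟩
      have h1 := norm_setIntegral_le_of_norm_le_const (μ := volume)
        (s := Metric.closedBall x R) (f := fun z => |fundSol s z - fundSol s x|) (C := D)
        measure_closedBall_lt_top (fun z hz => by
          rw [Real.norm_eq_abs, abs_abs]
          rw [Metric.mem_closedBall, dist_eq_norm] at hz
          refine hD x z (by linarith) ?_ hz
          have : ‖x‖ ≤ ‖z‖ + ‖z - x‖ := by simpa using norm_sub_le z (z - x)
          linarith)
      have hVx : (volume : Measure (EuclideanSpace ℝ (Fin n))).real (Metric.closedBall x R) = V := by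
        rw [hV, measureReal_def, measureReal_def, Measure.addHaar_closedBall_center]
      rw [hVx] at h1
      have : 0 ≤ M * (2 + R) ^ σ := by positivity
      exact (le_abs_self _).trans (h1.trans (by linarith))

end Kernel

/-! ### Convolution of the fundamental solution with compactly supported functions -/

section Potential

variable {n : ℕ} {s : ℝ}
  {F : Type*} [NormedAddCommGroup F] [NormedSpace ℝ F]

/-- The potential `x ↦ ∫ Φ(z) h(x - z) dz`. -/
def potential (s : ℝ) (h : EuclideanSpace ℝ (Fin n) → F) (x : EuclideanSpace ℝ (Fin n)) : F :=
  ∫ z, fundSol s z • h (x - z)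

/-- Integration by parts against the constant `1`. It makes the gradient of the potential bounded
even when `Φ` grows at infinity. -/
lemma integral_fderiv_eq_zero {f : EuclideanSpace ℝ (Fin n) → ℝ} (hf : ContDiff ℝ 1 f)
    (hfc : HasCompactSupport f) : ∫ x, fderiv ℝ f x = 0 := by
  have hc : Continuous (fderiv ℝ f) := hf.continuous_fderiv (by norm_num)
  have hi : Integrable (fderiv ℝ f) := hc.integrable_of_hasCompactSupport (hfc.fderiv ℝ)
  ext v
  rw [ContinuousLinearMap.integral_apply hi]
  have hiv : Integrable fun x => fderiv ℝ f x v := hi.apply_continuousLinearMap v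
  have := integral_mul_fderiv_eq_neg_fderiv_mul_of_integrable (𝕜 := ℝ) (μ := volume)
    (f := fun _ : EuclideanSpace ℝ (Fin n) => (1 : ℝ)) (g := f) (v := v) (by simp)
    (by simpa using hiv) (by simpa using hf.continuous.integrable_of_hasCompactSupport hfc)
    (fun _ _ => differentiableAt_const _) (fun x _ => (hf.differentiable (by norm_num)) x)
  simpa using this

lemma poissonSol_eq_potential (f : EuclideanSpace ℝ (Fin n) → ℝ) :
    poissonSol s f = potential s f := by
  ext x
  simp [poissonSol, convolution_def, potential]

variable [NeZero n]

lemma integrable_fundSol_smul (hs0 : 0 < s) (hs1 : s < 1)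
    {h : EuclideanSpace ℝ (Fin n) → F} (hc : Continuous h) {x : EuclideanSpace ℝ (Fin n)} {R : ℝ}
    (hR : ∀ z, R < ‖z - x‖ → h z = 0) : Integrable fun z => fundSol s z • h z := by
  have hcs : HasCompactSupport h :=
    HasCompactSupport.intro (isCompact_closedBall x R) fun z hz =>
      hR z (by simpa [dist_eq_norm] using hz)
  exact (locallyIntegrable_fundSol hs0 hs1).integrable_smul_right_of_hasCompactSupport hc hcs

/-- Replacing `Φ` by `Φ - c` changes the integral by `c ∫ h`, which is zero, so `h` is paired only
with the oscillation of `Φ` over the ball carrying its support. -/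
lemma norm_integral_fundSol_smul_le (hs0 : 0 < s) (hs1 : s < 1)
    {h : EuclideanSpace ℝ (Fin n) → F} (hc : Continuous h) {x : EuclideanSpace ℝ (Fin n)} {R : ℝ}
    (hR : ∀ z, R < ‖z - x‖ → h z = 0) {B : ℝ} (hB : ∀ z, ‖h z‖ ≤ B) {c : ℝ}
    (hz : c • ∫ z, h z = 0) :
    ‖∫ z, fundSol s z • h z‖ ≤ B * ∫ z in Metric.closedBall x R, |fundSol s z - c| := by
  have hcs : HasCompactSupport h :=
    HasCompactSupport.intro (isCompact_closedBall x R) fun z hz =>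
      hR z (by simpa [dist_eq_norm] using hz)
  have hi := integrable_fundSol_smul hs0 hs1 hc hR
  have hi2 : Integrable fun z => c • h z := (hc.integrable_of_hasCompactSupport hcs).smul c
  have e : ∫ z, fundSol s z • h z = ∫ z in Metric.closedBall x R, (fundSol s z - c) • h z := by
    rw [setIntegral_eq_integral_of_forall_compl_eq_zero (fun z hz => by
      rw [hR z (by simpa [dist_eq_norm] using hz), smul_zero])]
    simp only [sub_smul]
    rw [integral_sub hi hi2, integral_smul, hz, sub_zero]
  have hΦ : IntegrableOn (fun z => |fundSol s z - c|) (Metric.closedBall x R) :=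
    ((integrableOn_fundSol_closedBall hs0 hs1 x R).sub
      (integrableOn_const measure_closedBall_lt_top.ne)).norm
  rw [e, ← integral_const_mul]
  refine norm_integral_le_of_norm_le (hΦ.const_mul B) (Eventually.of_forall fun z => ?_)
  rw [norm_smul, mul_comm, Real.norm_eq_abs]
  gcongr
  exact hB z

/-- Growth of the potential. -/
lemma exists_norm_potential_le_growth (hs0 : 0 < s) (hs1 : s < 1) :
    ∃ σ : ℝ, 0 ≤ σ ∧ σ < 2 * s ∧ (2 * s < n → σ = 0) ∧ ∀ (h : EuclideanSpace ℝ (Fin n) → F),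
      Continuous h → HasCompactSupport h →
      ∃ A : ℝ, 0 ≤ A ∧ ∀ x, ∫ z, ‖fundSol s z • h (x - z)‖ ≤ A * (1 + ‖x‖) ^ σ := by
  obtain ⟨σ, hσ0, hσ, hσn, H⟩ := exists_integral_abs_fundSol_le (n := n) hs0 hs1
  refine ⟨σ, hσ0, hσ, hσn, fun h hc hcs => ?_⟩
  obtain ⟨B, hB⟩ := hcs.exists_bound_of_continuous hc
  have hB0 : 0 ≤ B := (norm_nonneg _).trans (hB 0)
  obtain ⟨R, hR0, hR⟩ := hcs.exists_pos_le_norm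
  obtain ⟨M, hM0, hM⟩ := H R hR0.le
  refine ⟨B * M, by positivity, fun x => ?_⟩
  have e : ∫ z, ‖fundSol s z • h (x - z)‖ =
      ∫ z in Metric.closedBall x R, ‖fundSol s z • h (x - z)‖ := by
    rw [setIntegral_eq_integral_of_forall_compl_eq_zero (fun z hz => ?_)]
    rw [Metric.mem_closedBall, dist_eq_norm, not_le, norm_sub_rev] at hz
    rw [hR _ hz.le, smul_zero, norm_zero]
  rw [e, mul_assoc]
  have h1 : ∫ z in Metric.closedBall x R, ‖fundSol s z • h (x - z)‖ ≤
      ∫ z in Metric.closedBall x R, B * |fundSol s z| := by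
    refine integral_mono_of_nonneg (Eventually.of_forall fun z => norm_nonneg _)
      ((integrableOn_fundSol_closedBall hs0 hs1 x R).norm.const_mul B)
      (Eventually.of_forall fun z => ?_)
    simp only
    rw [norm_smul, mul_comm, Real.norm_eq_abs]
    gcongr
    exact hB _
  rw [integral_const_mul] at h1
  exact h1.trans (mul_le_mul_of_nonneg_left (hM x) hB0)

/-- The potential of a function of mean zero is bounded. -/
lemma exists_norm_potential_le_of_integral_eq_zero (hs0 : 0 < s) (hs1 : s < 1)
    {h : EuclideanSpace ℝ (Fin n) → F} (hc : Continuous h) (hcs : HasCompactSupport h)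
    (h0 : ∫ z, h z = 0) : ∃ K : ℝ, 0 ≤ K ∧ ∀ x, ‖potential s h x‖ ≤ K := by
  obtain ⟨B, hB⟩ := hcs.exists_bound_of_continuous hc
  have hB0 : 0 ≤ B := (norm_nonneg _).trans (hB 0)
  obtain ⟨R, hR0, hR⟩ := hcs.exists_pos_le_norm
  obtain ⟨M, hM0, hM⟩ := exists_integral_abs_fundSol_sub_le (n := n) hs0 hs1 hR0.le
  refine ⟨B * M, by positivity, fun x => ?_⟩
  obtain ⟨c, hc'⟩ := hM x
  refine (norm_integral_fundSol_smul_le (h := fun z => h (x - z)) hs0 hs1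
    (hc.comp (by fun_prop)) (x := x) (R := R) (fun z hz => hR _ ?_) (fun z => hB _) (c := c)
    ?_).trans (mul_le_mul_of_nonneg_left hc' hB0)
  · rw [norm_sub_rev]; exact hz.le
  · rw [integral_sub_left_eq_self h volume x, h0, smul_zero]

/-- A bounded potential inherits the Hölder continuity of its density. -/
lemma exists_holder_potential (hs0 : 0 < s) (hs1 : s < 1)
    {h : EuclideanSpace ℝ (Fin n) → F} (hc : Continuous h) (hcs : HasCompactSupport h)
    {α H : ℝ} (hα : 0 ≤ α) (hH : ∀ x y, ‖h x - h y‖ ≤ H * ‖x - y‖ ^ α)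
    {K : ℝ} (hK : ∀ x, ‖potential s h x‖ ≤ K) :
    ∃ C : ℝ, 0 ≤ C ∧ ∀ x y, ‖potential s h x - potential s h y‖ ≤ C * ‖x - y‖ ^ α := by
  obtain ⟨R, hR0, hR⟩ := hcs.exists_pos_le_norm
  obtain ⟨M, hM0, hM⟩ := exists_integral_abs_fundSol_sub_le (n := n) hs0 hs1
    (R := R + 1) (by positivity)
  have hK0 : 0 ≤ K := (norm_nonneg _).trans (hK 0)
  refine ⟨2 * K + |H| * M, by positivity, fun x y => ?_⟩
  have hα' : 0 ≤ ‖x - y‖ ^ α := by positivity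
  -- For nearby points, `z ↦ h(x-z) - h(y-z)` has mean zero, is supported in the ball of radius `R +
  -- 1` about `x`, and has size at most `|H| ‖x-y‖ ^ α`. For distant points the bound `K` is enough
  -- because `‖x-y‖ ^ α ≥ 1`.
  rcases le_or_gt ‖x - y‖ 1 with hxy | hxy
  · obtain ⟨c, hc'⟩ := hM x
    have s1 : ∀ z, R + 1 < ‖z - x‖ → h (x - z) = 0 := fun z hz => hR _ (by
      rw [norm_sub_rev]; linarith)
    have s2 : ∀ z, R + 1 < ‖z - x‖ → h (y - z) = 0 := fun z hz => hR _ (by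
      have h1 : ‖z - x‖ ≤ ‖y - z‖ + ‖x - y‖ := by
        have := norm_add_le (y - z) (x - y)
        rw [sub_add_sub_comm, add_comm y x, add_sub_add_right_eq_sub, norm_sub_rev] at this
        exact this
      linarith)
    have c1 : Continuous fun z => h (x - z) := hc.comp (by fun_prop)
    have c2 : Continuous fun z => h (y - z) := hc.comp (by fun_prop)
    have hint := hc.integrable_of_hasCompactSupport (μ := volume) hcs
    have key := norm_integral_fundSol_smul_le (h := fun z => h (x - z) - h (y - z)) hs0 hs1
      (c1.sub c2) (x := x) (R := R + 1) (fun z hz => by rw [s1 z hz, s2 z hz, sub_zero])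
      (B := |H| * ‖x - y‖ ^ α) (fun z => by
        refine (hH _ _).trans ?_
        rw [sub_sub_sub_cancel_right]
        gcongr
        exact le_abs_self H) (c := c) (by
        rw [integral_sub (hint.comp_sub_left x) (hint.comp_sub_left y),
          integral_sub_left_eq_self h volume x, integral_sub_left_eq_self h volume y, sub_self,
          smul_zero])
    simp only [smul_sub] at key
    rw [integral_sub (integrable_fundSol_smul hs0 hs1 c1 s1)
      (integrable_fundSol_smul hs0 hs1 c2 s2)] at key
    refine key.trans ?_
    calc |H| * ‖x - y‖ ^ α * ∫ z in Metric.closedBall x (R + 1), |fundSol s z - c|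
        ≤ |H| * ‖x - y‖ ^ α * M := by gcongr
      _ = |H| * M * ‖x - y‖ ^ α := by ring
      _ ≤ _ := by gcongr; linarith
  · have h1 : 1 ≤ ‖x - y‖ ^ α := Real.one_le_rpow hxy.le hα
    calc ‖potential s h x - potential s h y‖ ≤ 2 * K :=
          (norm_sub_le _ _).trans (by linarith [hK x, hK y])
      _ ≤ 2 * K * ‖x - y‖ ^ α := le_mul_of_one_le_right (by positivity) h1
      _ ≤ _ := by gcongr; linarith [mul_nonneg (abs_nonneg H) hM0]

lemma fderiv_poissonSol (hs0 : 0 < s) (hs1 : s < 1) {f : EuclideanSpace ℝ (Fin n) → ℝ}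
    (hf : ContDiff ℝ 1 f) (hfc : HasCompactSupport f) :
    fderiv ℝ (poissonSol s f) = potential s (fderiv ℝ f) := by
  ext1 x
  rw [poissonSol, (hfc.hasFDerivAt_convolution_right (ContinuousLinearMap.mul ℝ ℝ)
    (locallyIntegrable_fundSol hs0 hs1) hf x).fderiv, convolution_def, potential]
  congr 1

end Potential

/-! ### Hölder classes -/

section Holder

variable {n : ℕ} {s ε : ℝ}

lemma continuous_of_holder {E F : Type*} [NormedAddCommGroup E] [NormedAddCommGroup F]
    {u : E → F} {C α : ℝ} (hα : 0 < α) (h : ∀ x y, ‖u x - u y‖ ≤ C * ‖x - y‖ ^ α) :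
    Continuous u := by
  refine continuous_iff_continuousAt.2 fun x => tendsto_iff_norm_sub_tendsto_zero.2 ?_
  refine squeeze_zero (fun y => norm_nonneg _) (fun y => h y x) ?_
  have hc : Continuous fun y : E => C * ‖y - x‖ ^ α :=
    continuous_const.mul (Continuous.rpow_const (by fun_prop) fun _ => Or.inr hα.le)
  have := hc.tendsto x
  simpa [Real.zero_rpow hα.ne'] using this

lemma MemHolder.continuous (hs0 : 0 < s) (hε : 0 < ε) {u : EuclideanSpace ℝ (Fin n) → ℝ}
    (hu : MemHolder s ε u) : Continuous u := by
  rcases lt_or_ge s (1 / 2) with hs | hs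
  · obtain ⟨C, hC⟩ := hu.1 hs
    exact continuous_of_holder (by linarith) hC
  · exact (hu.2 hs).1.continuous

/-- The second differences of a function of class `C^(2s+ε)`. -/
lemma MemHolder.exists_secondDiff_le (hε : 0 < ε)
    {u : EuclideanSpace ℝ (Fin n) → ℝ} (hu : MemHolder s ε u) :
    ∃ H : ℝ, 0 ≤ H ∧ ∀ x y, |secondDiff u x y| ≤ H * ‖y‖ ^ (2 * s + ε) := by
  rcases lt_or_ge s (1 / 2) with hs | hs
  · obtain ⟨C, hC⟩ := hu.1 hs
    refine ⟨2 * |C|, by positivity, fun x y => ?_⟩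
    have h1 := hC x (x + y)
    have h2 := hC x (x - y)
    have h3 := norm_secondDiff_le_diff u x y
    simp only [Real.norm_eq_abs] at h3
    rw [sub_add_cancel_left, norm_neg] at h1
    rw [sub_sub_cancel] at h2
    have h4 : C * ‖y‖ ^ (2 * s + ε) ≤ |C| * ‖y‖ ^ (2 * s + ε) := by
      gcongr; exact le_abs_self C
    linarith
  · obtain ⟨h1, -, C, hC⟩ := hu.2 hs
    refine ⟨|C| * 2 ^ (2 * s + ε - 1), by positivity, fun x y => ?_⟩
    rcases eq_or_ne y 0 with rfl | hy
    · have : secondDiff u x 0 = 0 := by simp [secondDiff, two_mul]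
      rw [this, abs_zero]
      positivity
    have hy' : 0 < ‖y‖ := norm_pos_iff.2 hy
    have hexp : 0 ≤ 2 * s + ε - 1 := by linarith
    -- The points `x ± t • y` are at distance at most `2‖y‖`, so the differentials differ by `O(‖y‖
    -- ^ (2s+ε-1))`; the mean value inequality supplies the missing factor `‖y‖`.
    have := norm_secondDiff_le_of_fderiv (u := u) (x := x) (y := y)
      (B := |C| * (2 * ‖y‖) ^ (2 * s + ε - 1)) (h1.differentiable (by norm_num)) (by
        intro t ht
        refine (hC _ _).trans ?_
        gcongr
        · exact le_abs_self C
        · have e : x + t • y - (x - t • y) = (2 * t) • y := by rw [mul_smul, two_smul]; abel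
          rw [e, norm_smul, Real.norm_of_nonneg (by linarith [ht.1])]
          gcongr
          linarith [ht.2])
    refine this.trans (le_of_eq ?_)
    rw [Real.mul_rpow (by norm_num) hy'.le, Real.rpow_sub_one hy'.ne' (2 * s + ε)]
    field_simp

variable [NeZero n]

lemma exists_abs_poissonSol_le (hs0 : 0 < s) (hs1 : s < 1) :
    ∃ σ : ℝ, 0 ≤ σ ∧ σ < 2 * s ∧ (2 * s < n → σ = 0) ∧ ∀ (f : EuclideanSpace ℝ (Fin n) → ℝ),
      Continuous f → HasCompactSupport f →
      ∃ A : ℝ, 0 ≤ A ∧ (∀ x, ∫ z, ‖fundSol s z • f (x - z)‖ ≤ A * (1 + ‖x‖) ^ σ) ∧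
        ∀ x, |poissonSol s f x| ≤ A * (1 + ‖x‖) ^ σ := by
  obtain ⟨σ, h0, h1, h2, h⟩ := exists_norm_potential_le_growth (n := n) (F := ℝ) hs0 hs1
  refine ⟨σ, h0, h1, h2, fun f hf hfc => ?_⟩
  obtain ⟨A, hA0, hA⟩ := h f hf hfc
  refine ⟨A, hA0, hA, fun x => ?_⟩
  rw [poissonSol_eq_potential]
  exact (norm_integral_le_integral_norm _).trans (hA x)

/-- If `s < 1/2` then `2s < n`, so `u` is bounded and inherits the Hölder exponent of `f`. If `s ≥
1/2`, then `u` may be unbounded, but its gradient is the potential of `∇f`, which has mean zero, and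
the same argument applies to the gradient. -/
lemma memHolder_poissonSol (hs0 : 0 < s) (hs1 : s < 1) (hε : 0 < ε)
    {f : EuclideanSpace ℝ (Fin n) → ℝ} (hf : MemHolder s ε f) (hfc : HasCompactSupport f) :
    MemHolder s ε (poissonSol s f) := by
  have hn : (1 : ℝ) ≤ n := by exact_mod_cast NeZero.one_le
  have hcont := hf.continuous hs0 hε
  refine ⟨fun hs => ?_, fun hs => ?_⟩
  · obtain ⟨σ, -, -, hσ, h⟩ := exists_abs_poissonSol_le (n := n) hs0 hs1
    obtain ⟨A, -, -, hA⟩ := h f hcont hfc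
    rw [hσ (by linarith)] at hA
    simp only [Real.rpow_zero, mul_one] at hA
    obtain ⟨H, hH⟩ := hf.1 hs
    rw [poissonSol_eq_potential] at hA ⊢
    obtain ⟨C, -, hC⟩ := exists_holder_potential hs0 hs1 hcont hfc (α := 2 * s + ε)
      (by linarith) hH hA
    exact ⟨C, hC⟩
  · obtain ⟨hf1, -, H, hH⟩ := hf.2 hs
    have hc' : Continuous (fderiv ℝ f) := hf1.continuous_fderiv (by norm_num)
    have hcs' : HasCompactSupport (fderiv ℝ f) := hfc.fderiv ℝ
    obtain ⟨K, -, hK⟩ := exists_norm_potential_le_of_integral_eq_zero (h := fderiv ℝ f)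
      hs0 hs1 hc' hcs' (integral_fderiv_eq_zero hf1 hfc)
    obtain ⟨C, -, hC⟩ := exists_holder_potential hs0 hs1 hc' hcs' (α := 2 * s + ε - 1)
      (by linarith) hH hK
    rw [fderiv_poissonSol hs0 hs1 hf1 hfc]
    refine ⟨?_, ⟨K, hK⟩, ⟨C, hC⟩⟩
    exact hfc.contDiff_convolution_right (n := 1) _ (locallyIntegrable_fundSol hs0 hs1) hf1

end Holder

/-! ### The Poisson equation -/

section Poisson

variable {n : ℕ} {s σ A : ℝ}

/-- The weight `1 + ‖x‖ ^ p` is comparable to `(1 + ‖x‖) ^ p`, so the quotient decays with exponent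
`n + 2s - σ > n`. -/
lemma memL1s_of_growth (hs0 : 0 < s) (hσ : σ < 2 * s)
    {u : EuclideanSpace ℝ (Fin n) → ℝ} (huc : Continuous u)
    (hu : ∀ x, |u x| ≤ A * (1 + ‖x‖) ^ σ) : MemL1s s u := by
  refine ⟨huc.locallyIntegrable, ?_⟩
  have hn : (0 : ℝ) ≤ n := Nat.cast_nonneg n
  set p := (n : ℝ) + 2 * s with hp
  have hp0 : 0 ≤ p := by rw [hp]; positivity
  have hcp : Continuous fun x : EuclideanSpace ℝ (Fin n) => ‖x‖ ^ p :=
    Continuous.rpow_const (by fun_prop) fun _ => Or.inr hp0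
  refine Integrable.mono' ((integrable_rpow_one_add_norm (n := n) (r := p - σ)
    (by rw [hp]; linarith)).const_mul (A * 2 ^ p)) ?_ (Eventually.of_forall fun x => ?_)
  · exact (huc.abs.measurable.div (continuous_const.add hcp).measurable).aestronglyMeasurable
  · have hx : 0 < 1 + ‖x‖ := by positivity
    have hA : 0 ≤ A * (1 + ‖x‖) ^ σ := (abs_nonneg _).trans (hu x)
    have h1 : (1 + ‖x‖) ^ p ≤ 2 ^ p * (1 + ‖x‖ ^ p) := by
      rcases le_total ‖x‖ 1 with h | h
      · have a1 : (1 + ‖x‖) ^ p ≤ 2 ^ p := Real.rpow_le_rpow hx.le (by linarith) hp0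
        have a2 : 0 ≤ (2 : ℝ) ^ p * ‖x‖ ^ p := by positivity
        linarith
      · have a1 : (1 + ‖x‖) ^ p ≤ (2 * ‖x‖) ^ p := Real.rpow_le_rpow hx.le (by linarith) hp0
        rw [Real.mul_rpow zero_le_two (norm_nonneg _)] at a1
        have a2 : (0 : ℝ) ≤ 2 ^ p := by positivity
        linarith
    rw [Real.norm_of_nonneg (by positivity), div_le_iff₀ (by positivity)]
    have e : (1 + ‖x‖) ^ (-(p - σ)) = (1 + ‖x‖) ^ σ * ((1 + ‖x‖) ^ p)⁻¹ := by
      rw [← Real.rpow_neg hx.le, ← Real.rpow_add hx]; congr 1; ring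
    calc |u x| ≤ A * (1 + ‖x‖) ^ σ := hu x
      _ ≤ A * (1 + ‖x‖) ^ σ * (2 ^ p * (1 + ‖x‖ ^ p) * ((1 + ‖x‖) ^ p)⁻¹) := by
          refine le_mul_of_one_le_right hA ?_
          rw [← div_eq_mul_inv, le_div_iff₀ (by positivity), one_mul]
          exact h1
      _ = _ := by rw [e]; ring

variable [NeZero n]

/-- Fubini moves the convolution with `Φ` onto `(-Δ)^s φ`, where the inversion formula gives `φ`.
Absolute convergence is why the growth bound is required of the integral of `|Φ(z) f(x-z)|` and not
only of `u`. -/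
lemma integral_poissonSol_mul_schwartzFracLap (hs0 : 0 < s) (hs1 : s < 1)
    (hσ : σ < 2 * s) {f : EuclideanSpace ℝ (Fin n) → ℝ} (hf : Continuous f)
    (hfc : HasCompactSupport f)
    (hA : ∀ x, ∫ z, ‖fundSol s z • f (x - z)‖ ≤ A * (1 + ‖x‖) ^ σ)
    (φ : 𝓢(EuclideanSpace ℝ (Fin n), ℝ)) :
    ∫ x, poissonSol s f x * schwartzFracLap s φ x = ∫ x, f x * φ x := by
  obtain ⟨B, hB0, hB⟩ := exists_abs_schwartzFracLap_le hs0 hs1 φ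
  have hψ := continuous_schwartzFracLap hs0 hs1 φ
  set ψ := schwartzFracLap s φ with hψdef
  have hex : ∀ x, Integrable fun z => fundSol s z • f (x - z) := fun x =>
    hfc.convolutionExists_right (ContinuousLinearMap.mul ℝ ℝ)
      (locallyIntegrable_fundSol hs0 hs1) hf x
  set G : EuclideanSpace ℝ (Fin n) → EuclideanSpace ℝ (Fin n) → ℝ := fun x y =>
    fundSol s (x - y) • f y * ψ x with hG
  have hGm : AEStronglyMeasurable (Function.uncurry G) (volume.prod volume) := by
    refine Measurable.aestronglyMeasurable ?_
    exact (((measurable_fundSol s).comp (measurable_fst.sub measurable_snd)).mul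
      (hf.measurable.comp measurable_snd)).mul (hψ.measurable.comp measurable_fst)
  have hGi : Integrable (Function.uncurry G) (volume.prod volume) := by
    refine (integrable_prod_iff hGm).2 ⟨Eventually.of_forall fun x => ?_, ?_⟩
    · have := ((hex x).comp_sub_left x).mul_const (ψ x)
      simp only [sub_sub_cancel] at this
      exact this
    · refine Integrable.mono' ((integrable_rpow_one_add_norm (n := n) (r := n + 2 * s - σ)
        (by linarith)).const_mul (A * B)) hGm.norm.integral_prod_right'
        (Eventually.of_forall fun x => ?_)
      have e : ∫ y, ‖fundSol s (x - y) • f y‖ = ∫ z, ‖fundSol s z • f (x - z)‖ := by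
        rw [← integral_sub_left_eq_self (fun z => ‖fundSol s z • f (x - z)‖) volume x]
        simp only [sub_sub_cancel]
      have hx : 0 < 1 + ‖x‖ := by positivity
      simp only [Function.uncurry_apply_pair, hG, norm_mul _ (ψ x)]
      rw [integral_mul_const, e, norm_mul, norm_norm,
        Real.norm_of_nonneg (integral_nonneg fun _ => norm_nonneg _)]
      calc _ ≤ (A * (1 + ‖x‖) ^ σ) * (B * (1 + ‖x‖) ^ (-((n : ℝ) + 2 * s))) :=
            mul_le_mul (hA x) (hB x) (abs_nonneg _)
              ((integral_nonneg fun _ => norm_nonneg _).trans (hA x))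
        _ = A * B * ((1 + ‖x‖) ^ σ * (1 + ‖x‖) ^ (-((n : ℝ) + 2 * s))) := by ring
        _ = _ := by rw [← Real.rpow_add hx]; congr 2; ring
  have hswap := integral_integral_swap hGi
  have e1 : ∀ x, ∫ y, G x y = poissonSol s f x * ψ x := by
    intro x
    rw [poissonSol_eq_potential, potential,
      ← integral_sub_left_eq_self (fun z => fundSol s z • f (x - z)) volume x]
    simp only [sub_sub_cancel, hG]
    rw [integral_mul_const]
  -- Evenness of `Φ` puts this integral in the form of the inversion formula at `y`.
  have e2 : ∀ y, ∫ x, G x y = f y * φ y := by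
    intro y
    rw [← integral_fundSol_mul_schwartzFracLap hs0 hs1 φ y, ← integral_const_mul,
      ← integral_sub_left_eq_self (fun x => G x y) volume y]
    congr 1; ext z
    simp only [hG, sub_sub_cancel_left, fundSol_neg, smul_eq_mul]
    ring
  simp only [e1, e2] at hswap
  exact hswap

lemma isDistribSolution_poissonSol (hs0 : 0 < s) (hs1 : s < 1) (hσ : σ < 2 * s)
    {f : EuclideanSpace ℝ (Fin n) → ℝ} (hf : Continuous f) (hfc : HasCompactSupport f)
    (huc : Continuous (poissonSol s f))
    (hA : ∀ x, ∫ z, ‖fundSol s z • f (x - z)‖ ≤ A * (1 + ‖x‖) ^ σ)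
    (hu : ∀ x, |poissonSol s f x| ≤ A * (1 + ‖x‖) ^ σ) :
    IsDistribSolution s (poissonSol s f) f := by
  intro φ
  refine ⟨schwartzFracLap s φ, hasFracLaplacianAt_schwartz hs0 hs1 φ,
    memSs_symmIntegral hs0 hs1 _ φ, ?_, ?_,
    integral_poissonSol_mul_schwartzFracLap hs0 hs1 hσ hf hfc hA φ⟩
  · refine ((integrable_mul_symmIntegral hs0 hs1 hσ huc hu φ).const_mul
      (normConst n s / 2)).congr (Eventually.of_forall fun x => ?_)
    simp only [schwartzFracLap]
    ring
  · exact (hf.mul φ.continuous).integrable_of_hasCompactSupport hfc.mul_right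

/-- Symmetry moves the operator from test functions to `u`, so the symmetrized integral of `u` and
`f` coincide as distributions, hence almost everywhere. Both are continuous, hence they coincide
everywhere. -/
lemma hasFracLaplacianAt_of_isDistribSolution {b H : ℝ} (hs0 : 0 < s) (hs1 : s < 1)
    (hσ0 : 0 ≤ σ) (hσ : σ < 2 * s) (hb : 2 * s < b) (hA0 : 0 ≤ A) (hH : 0 ≤ H)
    {u f : EuclideanSpace ℝ (Fin n) → ℝ} (hf : Continuous f) (huc : Continuous u)
    (hu : ∀ x, |u x| ≤ A * (1 + ‖x‖) ^ σ) (hD : ∀ x y, |secondDiff u x y| ≤ H * ‖y‖ ^ b)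
    (hsol : ∀ φ : 𝓢(EuclideanSpace ℝ (Fin n), ℝ),
      ∫ x, u x * schwartzFracLap s φ x = ∫ x, f x * φ x) (x : EuclideanSpace ℝ (Fin n)) :
    HasFracLaplacianAt s u x (f x) := by
  have hS := continuous_symmIntegral_of_growth hσ0 hσ hb hA0 hH huc hu hD
  have hv : Continuous fun x => normConst n s / 2 * symmIntegral ((n : ℝ) + 2 * s) u x :=
    continuous_const.mul hS
  have hae : (fun x => normConst n s / 2 * symmIntegral ((n : ℝ) + 2 * s) u x) =ᵐ[volume] f := by
    refine ae_eq_of_integral_contDiff_smul_eq hv.locallyIntegrable hf.locallyIntegrable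
      fun g hg hgc => ?_
    have h1 := integral_symmIntegral_mul hs0 hs1 hσ0 hσ hb hA0 hH huc hu hD (hgc.toSchwartzMap hg)
    have h2 := hsol (hgc.toSchwartzMap hg)
    simp only [schwartzFracLap, mul_left_comm (u _)] at h2
    rw [integral_const_mul, ← h1, ← integral_const_mul] at h2
    refine Eq.trans ?_ (h2.trans ?_)
    · congr 1; ext y
      have : hgc.toSchwartzMap hg y = g y := rfl
      rw [this, smul_eq_mul]; ring
    · congr 1; ext y
      have : hgc.toSchwartzMap hg y = g y := rfl
      rw [this, smul_eq_mul, mul_comm]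
  have heq := (Continuous.ae_eq_iff_eq volume hv hf).1 hae
  rw [← congrFun heq x]
  exact hasFracLaplacianAt_of_integrable hσ0 hσ hA0 huc hu x
    (integrable_symm_of_growth hσ0 hσ hb hA0 hH huc hu hD x)

end Poisson

end

end FracLap

theorem theorem2p6 (n : ℕ) [NeZero n] (s ε : ℝ) (hs0 : 0 < s) (hs1 : s < 1) (hε : 0 < ε)
    (hε₁ : s < 1 / 2 → 2 * s + ε ≤ 1) (hε₂ : 1 / 2 ≤ s → 2 * s + ε ≤ 2)
    (f : EuclideanSpace ℝ (Fin n) → ℝ)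
    (hf : FracLap.MemHolder s ε f) (hfc : HasCompactSupport f) :
    ConvolutionExists (FracLap.fundSol s) f (ContinuousLinearMap.mul ℝ ℝ) volume ∧
    FracLap.MemL1s s (FracLap.poissonSol s f) ∧
    FracLap.IsDistribSolution s (FracLap.poissonSol s f) f ∧
    FracLap.MemHolder s ε (FracLap.poissonSol s f) ∧
    (2 * s < (n : ℝ) → ∃ M : ℝ, ∀ x, |FracLap.poissonSol s f x| ≤ M) ∧
    ∀ x, FracLap.HasFracLaplacianAt s (FracLap.poissonSol s f) x (f x) := by
  have hcont := hf.continuous hs0 hε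
  have hloc := FracLap.locallyIntegrable_fundSol (n := n) hs0 hs1
  obtain ⟨σ, hσ0, hσ, hσn, h⟩ := FracLap.exists_abs_poissonSol_le (n := n) hs0 hs1
  obtain ⟨A, hA0, hA, hu⟩ := h f hcont hfc
  have huc : Continuous (FracLap.poissonSol s f) :=
    hfc.continuous_convolution_right _ hloc hcont
  have hmem := FracLap.memHolder_poissonSol hs0 hs1 hε hf hfc
  obtain ⟨H, hH0, hH⟩ := hmem.exists_secondDiff_le hε
  refine ⟨hfc.convolutionExists_right _ hloc hcont, FracLap.memL1s_of_growth hs0 hσ huc hu,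
    FracLap.isDistribSolution_poissonSol hs0 hs1 hσ hcont hfc huc hA hu, hmem, fun hn => ?_, ?_⟩
  · refine ⟨A, fun x => ?_⟩
    have := hu x
    rwa [hσn hn, Real.rpow_zero, mul_one] at this
  · exact FracLap.hasFracLaplacianAt_of_isDistribSolution hs0 hs1 hσ0 hσ (by linarith) hA0 hH0
      hcont huc hu hH
      (FracLap.integral_poissonSol_mul_schwartzFracLap hs0 hs1 hσ hcont hfc hA)
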